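/- For $\alpha\in(0,1/2)$ let $f_\alpha:[0,1]\to[0,1]$ be the map given by $f_\alpha(1)=0$ and, for every integer $j\ge 1$, $$f_\alpha(x)=x-1+2\alpha^{j-1}-\alpha^{j}\quad\text{for } x\in[1-\alpha^{j-1},\,1-\alpha^{j-1}+\alpha^{j}],$$ $$f_\alpha(x)=\frac{1-\alpha+\alpha^2}{2\alpha-1}(x-1)+\alpha^{j+1}\,\frac{2-\alpha}{2\alpha-1}\quad\text{for } x\in(1-\alpha^{j-1}+\alpha^{j},\,1-\alpha^{j}).$$ For a binary word $u=u_1\dots u_k$ let $I_\alpha(u)=[\kappa(u),\kappa(u)+\alpha^k]$, where $\kappa(u)=(1-\alpha)\sum_{i=1}^{k}u_i\alpha^{i-1}$, let $X_\alpha=\bigcap_{k\ge 1}\bigcup_{u\in\{0,1\}^k}I_\alpha(u)$, and let $\mu_\alpha$ be the unique Borel probability measure with $\mu_\alpha(I_\alpha(u))=2^{-k}$ for all $k\ge 1$ and $u\in\{0,1\}^k$ and $\mu_\alpha([0,1]\setminus X_\alpha)=0$. Equivalently, $\mu_\alpha$ is the law of $(1-\alpha)\sum_{i\ge 1}u_i\alpha^{i-1}$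 for independent fair bits $u_i\in\{0,1\}$. For $\varepsilon>0$ and $\ell\in\{1,\infty\}$ put $$c_\ell(\alpha,\varepsilon)=(\mu_\alpha\times\mu_\alpha)\{(x,y): \sup_{0\le i<\ell}|f_\alpha^i(x)-f_\alpha^i(y)|\le\varepsilon\},$$ and let $$\mathrm{det}^\infty_{f_\alpha}(\mu_\alpha,\varepsilon)=\frac{c_\infty(\alpha,\varepsilon)}{c_1(\alpha,\varepsilon)}$$ be the asymptotic determinism in the infinite horizon. Then: (i) for every $\overline d\in(1/2,1]$ there is $\alpha\in(0,1/2)$ with $\limsup_{\varepsilon\to0^+}\mathrm{det}^\infty_{f_\alpha}(\mu_\alpha,\varepsilon)=\overline d$; (ii) for every $\underline d\in(1/3,8/15]$ there is $\alpha\in(0,1/2)$ with $\liminf_{\varepsilon\to0^+}\mathrm{det}^\infty_{f_\alpha}(\mu_\alpha,\varepsilon)=\underline d$. -/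

import Mathlib

open Set Filter Topology MeasureTheory ProbabilityTheory

/-! ### The maps `f_α` -/

open Classical in
/-- The map `f_α : [0, 1] → [0, 1]`, `0 < α < 1/2`, given by its explicit piecewise linear formula
(extended by the value `0` to the rest of the real line, which plays no role). For
`0 < α < 1/2` the intervals belonging to different `j` are disjoint, see `delahaye_of_mem_Icc`,
`delahaye_of_mem_Ioo`, `delahaye_one` below for the defining formulas. -/
noncomputable def delahaye (α x : ℝ) : ℝ :=
  if h : ∃ j : ℕ, 1 ≤ j ∧ x ∈ Icc (1 - α ^ (j - 1)) (1 - α ^ (j - 1) + α ^ j) then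
    x - 1 + 2 * α ^ (Nat.find h - 1) - α ^ Nat.find h
  else if h : ∃ j : ℕ, 1 ≤ j ∧ x ∈ Ioo (1 - α ^ (j - 1) + α ^ j) (1 - α ^ j) then
    (1 - α + α ^ 2) / (2 * α - 1) * (x - 1)
      + α ^ (Nat.find h + 1) * ((2 - α) / (2 * α - 1))
  else 0

theorem delahaye_level_unique {α x : ℝ} (hα : α ∈ Ioo (0 : ℝ) (1 / 2)) {i j : ℕ}
    (hi : 1 ≤ i) (hj : 1 ≤ j) (hxi : x ∈ Ico (1 - α ^ (i - 1)) (1 - α ^ i))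
    (hxj : x ∈ Ico (1 - α ^ (j - 1)) (1 - α ^ j)) : i = j := by
  have key : ∀ i j : ℕ, 1 ≤ i → i < j → x < 1 - α ^ i → 1 - α ^ (j - 1) ≤ x → False := by
    intro i j _ hij h1 h2
    have : α ^ (j - 1) ≤ α ^ i :=
      pow_le_pow_of_le_one hα.1.le (by linarith [hα.2]) (by omega)
    linarith
  rcases lt_trichotomy i j with h | h | h
  · exact (key i j hi h hxi.2 hxj.1).elim
  · exact h
  · exact (key j i hj h hxj.2 hxi.1).elim

theorem delahaye_gap {α : ℝ} (hα : α ∈ Ioo (0 : ℝ) (1 / 2)) {j : ℕ} (hj : 1 ≤ j) :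
    0 < α ^ j ∧ 1 - α ^ (j - 1) + α ^ j < 1 - α ^ j := by
  obtain ⟨k, rfl⟩ : ∃ k, j = k + 1 := ⟨j - 1, by omega⟩
  have h0 : 0 < α ^ k := pow_pos hα.1 k
  refine ⟨pow_pos hα.1 _, ?_⟩
  simp only [Nat.add_sub_cancel, pow_succ]
  nlinarith [hα.2]

theorem delahaye_of_mem_Icc {α x : ℝ} (hα : α ∈ Ioo (0 : ℝ) (1 / 2)) {j : ℕ} (hj : 1 ≤ j)
    (hx : x ∈ Icc (1 - α ^ (j - 1)) (1 - α ^ (j - 1) + α ^ j)) :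
    delahaye α x = x - 1 + 2 * α ^ (j - 1) - α ^ j := by
  classical
  have h : ∃ j : ℕ, 1 ≤ j ∧ x ∈ Icc (1 - α ^ (j - 1)) (1 - α ^ (j - 1) + α ^ j) := ⟨j, hj, hx⟩
  have hf := Nat.find_spec h
  have e : Nat.find h = j := delahaye_level_unique hα hf.1 hj
    ⟨hf.2.1, hf.2.2.trans_lt (delahaye_gap hα hf.1).2⟩
    ⟨hx.1, hx.2.trans_lt (delahaye_gap hα hj).2⟩
  unfold delahaye
  rw [dif_pos h]
  convert rfl using 3 <;> simp [← e]

theorem delahaye_of_mem_Ioo {α x : ℝ} (hα : α ∈ Ioo (0 : ℝ) (1 / 2)) {j : ℕ} (hj : 1 ≤ j)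
    (hx : x ∈ Ioo (1 - α ^ (j - 1) + α ^ j) (1 - α ^ j)) :
    delahaye α x = (1 - α + α ^ 2) / (2 * α - 1) * (x - 1)
      + α ^ (j + 1) * ((2 - α) / (2 * α - 1)) := by
  classical
  have hmem : ∀ i : ℕ, 1 ≤ i → x ∈ Ioo (1 - α ^ (i - 1) + α ^ i) (1 - α ^ i) →
      x ∈ Ico (1 - α ^ (i - 1)) (1 - α ^ i) := fun i hi hxi =>
    ⟨by linarith [hxi.1, (delahaye_gap hα hi).1], hxi.2⟩
  have h : ∃ j : ℕ, 1 ≤ j ∧ x ∈ Ioo (1 - α ^ (j - 1) + α ^ j) (1 - α ^ j) := ⟨j, hj, hx⟩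
  have hn : ¬ ∃ j : ℕ, 1 ≤ j ∧ x ∈ Icc (1 - α ^ (j - 1)) (1 - α ^ (j - 1) + α ^ j) := by
    rintro ⟨i, hi, hxi⟩
    have := delahaye_level_unique hα hi hj
      ⟨hxi.1, hxi.2.trans_lt (delahaye_gap hα hi).2⟩ (hmem j hj hx)
    subst this
    exact absurd hxi.2 (not_le.2 hx.1)
  have hf := Nat.find_spec h
  have e : Nat.find h = j := delahaye_level_unique hα hf.1 hj (hmem _ hf.1 hf.2) (hmem j hj hx)
  unfold delahaye
  rw [dif_neg hn, dif_pos h]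
  convert rfl using 4
  exact congrArg (· + 1) e.symm

theorem delahaye_one {α : ℝ} (hα : α ∈ Ioo (0 : ℝ) (1 / 2)) : delahaye α 1 = 0 := by
  classical
  unfold delahaye
  rw [dif_neg, dif_neg]
  · rintro ⟨i, hi, hxi⟩
    linarith [hxi.2, (delahaye_gap hα hi).1]
  · rintro ⟨i, hi, hxi⟩
    linarith [hxi.2, (delahaye_gap hα hi).1, (delahaye_gap hα hi).2]

/-! ### The measures `μ_α` -/

/-- The coding map `κ_α(u₁u₂…) = (1 - α)(u₁ + u₂ α + u₃ α² + …)` on infinite binary words. -/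
noncomputable def kappa (α : ℝ) (u : ℕ → Bool) : ℝ :=
  (1 - α) * ∑' i : ℕ, (if u i then 1 else 0) * α ^ i

/-- The value `κ_α(u 0^∞)` for a finite binary word `u` of length `k`. -/
noncomputable def kappaFin (α : ℝ) {k : ℕ} (u : Fin k → Bool) : ℝ :=
  (1 - α) * ∑ i : Fin k, (if u i then 1 else 0) * α ^ (i : ℕ)

/-- The interval `I_α(u) = [κ_α(u), κ_α(u) + α^k]` of a binary word `u` of length `k`. -/
def wordInterval (α : ℝ) {k : ℕ} (u : Fin k → Bool) : Set ℝ :=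
  Icc (kappaFin α u) (kappaFin α u + α ^ k)

/-- The Cantor set `X_α = ⋂_{k ≥ 1} ⋃_{|u| = k} I_α(u)`. -/
def cantorX (α : ℝ) : Set ℝ :=
  ⋂ k : ℕ, ⋂ _ : 1 ≤ k, ⋃ u : Fin k → Bool, wordInterval α u

/-- The law of an infinite sequence of independent fair bits. -/
noncomputable def coinMeasure : Measure (ℕ → Bool) :=
  Measure.infinitePi fun _ : ℕ => uniformOn (univ : Set Bool)

/-- The measure `μ_α`: the image of the fair coin-tossing measure under the coding `κ_α`. It is
the probability measure with `μ_α (I_α(u)) = 2^{-k}` for every word `u` of length `k` and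
`μ_α (X_αᶜ) = 0`, see `muAlpha_wordInterval` and `muAlpha_compl_cantorX`. -/
noncomputable def muAlpha (α : ℝ) : Measure ℝ :=
  coinMeasure.map (kappa α)

instance : IsProbabilityMeasure coinMeasure := by
  unfold coinMeasure; infer_instance

theorem kappa_term_bound {α : ℝ} (hα : α ∈ Ioo (0 : ℝ) (1 / 2)) (b : Bool) (i : ℕ) :
    0 ≤ (if b then (1 : ℝ) else 0) * α ^ i ∧ (if b then (1 : ℝ) else 0) * α ^ i ≤ α ^ i := by
  have : 0 ≤ α ^ i := pow_nonneg hα.1.le i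
  cases b <;> simp [this]

theorem summable_kappa {α : ℝ} (hα : α ∈ Ioo (0 : ℝ) (1 / 2)) (u : ℕ → Bool) :
    Summable fun i : ℕ => (if u i then (1 : ℝ) else 0) * α ^ i :=
  Summable.of_nonneg_of_le (fun i => (kappa_term_bound hα (u i) i).1)
    (fun i => (kappa_term_bound hα (u i) i).2)
    (summable_geometric_of_lt_one hα.1.le (by linarith [hα.2]))

theorem continuous_kappa {α : ℝ} (hα : α ∈ Ioo (0 : ℝ) (1 / 2)) : Continuous (kappa α) := by
  unfold kappa
  refine continuous_const.mul (continuous_tsum (u := fun i => α ^ i) ?_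
    (summable_geometric_of_lt_one hα.1.le (by linarith [hα.2])) ?_)
  · intro i
    exact (((continuous_of_discreteTopology (f := fun b : Bool => if b then (1 : ℝ) else 0)).comp
      (continuous_apply i))).mul continuous_const
  · intro i u
    have := kappa_term_bound hα (u i) i
    rw [Real.norm_eq_abs, abs_of_nonneg this.1]
    exact this.2

theorem measurable_kappa {α : ℝ} (hα : α ∈ Ioo (0 : ℝ) (1 / 2)) : Measurable (kappa α) :=
  (continuous_kappa hα).measurable

theorem isProbabilityMeasure_muAlpha {α : ℝ} (hα : α ∈ Ioo (0 : ℝ) (1 / 2)) :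
    IsProbabilityMeasure (muAlpha α) :=
  Measure.isProbabilityMeasure_map (measurable_kappa hα).aemeasurable

theorem kappa_mem {α : ℝ} (hα : α ∈ Ioo (0 : ℝ) (1 / 2)) (u : ℕ → Bool) :
    kappa α u ∈ Icc (0 : ℝ) 1 := by
  have h1 : (0 : ℝ) < 1 - α := by linarith [hα.2]
  have hg := summable_geometric_of_lt_one hα.1.le (by linarith [hα.2])
  have hle := (summable_kappa hα u).tsum_le_tsum
    (fun i => (kappa_term_bound hα (u i) i).2) hg
  rw [tsum_geometric_of_lt_one hα.1.le (by linarith [hα.2])] at hle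
  refine ⟨mul_nonneg h1.le (tsum_nonneg fun i => (kappa_term_bound hα (u i) i).1), ?_⟩
  calc kappa α u ≤ (1 - α) * (1 - α)⁻¹ := mul_le_mul_of_nonneg_left hle h1.le
    _ = 1 := mul_inv_cancel₀ h1.ne'

theorem kappa_succ {α : ℝ} (hα : α ∈ Ioo (0 : ℝ) (1 / 2)) (u : ℕ → Bool) :
    kappa α u = (1 - α) * (if u 0 then 1 else 0) + α * kappa α (fun i => u (i + 1)) := by
  have h : ∀ i : ℕ, (if u (i + 1) then (1 : ℝ) else 0) * α ^ (i + 1) =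
      α * ((if u (i + 1) then (1 : ℝ) else 0) * α ^ i) := fun i => by ring
  unfold kappa
  rw [(summable_kappa hα u).tsum_eq_zero_add]
  simp only [h]
  rw [tsum_mul_left]
  ring

theorem kappaFin_succ (α : ℝ) {k : ℕ} (u : Fin (k + 1) → Bool) :
    kappaFin α u = (1 - α) * (if u 0 then 1 else 0) + α * kappaFin α (fun i => u i.succ) := by
  have h : ∀ i : Fin k, (if u i.succ then (1 : ℝ) else 0) * α ^ ((i : ℕ) + 1) =
      α * ((if u i.succ then (1 : ℝ) else 0) * α ^ (i : ℕ)) := fun i => by ring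
  unfold kappaFin
  rw [Fin.sum_univ_succ]
  simp only [Fin.val_zero, Fin.val_succ, h]
  rw [← Finset.mul_sum]
  ring

theorem kappaFin_mem {α : ℝ} (hα : α ∈ Ioo (0 : ℝ) (1 / 2)) {k : ℕ} (u : Fin k → Bool) :
    0 ≤ kappaFin α u ∧ kappaFin α u + α ^ k ≤ 1 := by
  obtain ⟨h0, h1⟩ := hα
  induction k with
  | zero => simp [kappaFin]
  | succ k ih =>
    obtain ⟨ih0, ih1⟩ := ih fun i => u i.succ
    rw [kappaFin_succ, pow_succ]
    have := mul_nonneg h0.le ih0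
    cases u 0 <;> simp <;> constructor <;> nlinarith

theorem kappa_mem_wordInterval {α : ℝ} (hα : α ∈ Ioo (0 : ℝ) (1 / 2)) {k : ℕ}
    (u : Fin k → Bool) (v : ℕ → Bool) :
    kappa α v ∈ wordInterval α u ↔ ∀ i : Fin k, v i = u i := by
  obtain ⟨h0, h1⟩ := id hα
  induction k generalizing v with
  | zero => simpa [wordInterval, kappaFin] using kappa_mem hα v
  | succ k ih =>
    rw [Fin.forall_fin_succ]
    have hih := ih (fun i => u i.succ) (fun i => v (i + 1))
    simp only [wordInterval, mem_Icc] at hih ⊢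
    rw [kappa_succ hα v, kappaFin_succ, pow_succ]
    simp only [Fin.val_zero, Fin.val_succ]
    rw [← hih]
    obtain ⟨a0, a1⟩ := kappa_mem hα fun i => v (i + 1)
    obtain ⟨b0, b1⟩ := kappaFin_mem hα fun i => u i.succ
    set A := kappa α fun i => v (i + 1)
    set B := kappaFin α fun i => u i.succ
    have hp : 0 ≤ α ^ k := pow_nonneg h0.le k
    have same : (α * B ≤ α * A ∧ α * A ≤ α * B + α ^ k * α) ↔ (B ≤ A ∧ A ≤ B + α ^ k) := by
      rw [mul_le_mul_iff_right₀ h0, mul_comm (α ^ k), ← mul_add, mul_le_mul_iff_right₀ h0]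
    cases hv : v 0 <;> cases hu : u 0 <;> simp [add_assoc, same]
    · intro h; nlinarith
    · intro h; nlinarith

theorem muAlpha_wordInterval {α : ℝ} (hα : α ∈ Ioo (0 : ℝ) (1 / 2)) {k : ℕ}
    (u : Fin k → Bool) : muAlpha α (wordInterval α u) = 2⁻¹ ^ k := by
  have hset : kappa α ⁻¹' wordInterval α u =
      Set.pi (Finset.range k) fun i => if h : i < k then {u ⟨i, h⟩} else univ := by
    ext v
    rw [mem_preimage, kappa_mem_wordInterval hα]
    simp only [Set.mem_pi, Finset.coe_range, mem_Iio]
    constructor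
    · intro h i hi
      simp [hi, h ⟨i, hi⟩]
    · intro h i
      simpa [i.2] using h i i.2
  rw [muAlpha, Measure.map_apply (measurable_kappa hα) (s := wordInterval α u) measurableSet_Icc, hset, coinMeasure,
    Measure.infinitePi_pi _ (fun i _ => MeasurableSet.of_discrete)]
  rw [Finset.prod_congr rfl (g := fun _ => (2⁻¹ : ENNReal)), Finset.prod_const, Finset.card_range]
  intro i hi
  rw [dif_pos (Finset.mem_range.1 hi), uniformOn_univ]
  simp

theorem muAlpha_compl_cantorX {α : ℝ} (hα : α ∈ Ioo (0 : ℝ) (1 / 2)) :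
    muAlpha α (cantorX α)ᶜ = 0 := by
  have hm : MeasurableSet (cantorX α) :=
    MeasurableSet.iInter fun k => MeasurableSet.iInter fun _ =>
      MeasurableSet.iUnion fun u => measurableSet_Icc
  rw [muAlpha, Measure.map_apply (measurable_kappa hα) hm.compl]
  convert measure_empty (μ := coinMeasure)
  ext v
  simp only [mem_preimage, mem_compl_iff, mem_empty_iff_false, iff_false, not_not]
  simp only [cantorX, mem_iInter, mem_iUnion]
  exact fun k _ => ⟨fun i => v i, (kappa_mem_wordInterval hα _ v).2 fun _ => rfl⟩

/-! ### Correlation integrals and determinism -/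

/-- The distance `ϱ_ℓ(x, y) = sup {ϱ(gⁱ x, gⁱ y) | 0 ≤ i < ℓ}`, `1 ≤ ℓ ≤ ∞`, with values in
`[0, ∞]`. -/
noncomputable def orbitDist {M : Type*} [PseudoEMetricSpace M] (g : M → M) (l : ℕ∞) (x y : M) :
    ENNReal :=
  ⨆ i : ℕ, ⨆ _ : (i : ℕ∞) < l, edist (g^[i] x) (g^[i] y)

/-- The `ℓ`-correlation integral `c_ℓ^g(ν, ε) = ν × ν {(x, y) | ϱ_ℓ(x, y) ≤ ε}`. -/
noncomputable def corrIntegral {M : Type*} [PseudoEMetricSpace M] [MeasurableSpace M]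
    (g : M → M) (ν : Measure M) (l : ℕ∞) (ε : ℝ) : ℝ :=
  (ν.prod ν).real {p | orbitDist g l p.1 p.2 ≤ ENNReal.ofReal ε}

/-- The asymptotic determinism in the infinite horizon,
`det_∞^g(ν, ε) = c_∞^g(ν, ε) / c_1^g(ν, ε)`. -/
noncomputable def detInfty {M : Type*} [PseudoEMetricSpace M] [MeasurableSpace M]
    (g : M → M) (ν : Measure M) (ε : ℝ) : ℝ :=
  corrIntegral g ν ⊤ ε / corrIntegral g ν 1 ε

/-!
Code a point of the Cantor set `X_α` by its binary digits and read the digit sequence as a 2-adic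
integer. Then `f_α` becomes the odometer `u ↦ u + 1` (`delahaye_kappa`). The difference `z = v - u`
of two points is constant along their orbits, the coding map `κ` is subadditive, and orbits of the
odometer come arbitrarily close to `0`; hence the supremum of the distances along the orbits is
`max (κ z) (κ (-z))` (`forall_abs_kappa_odometer_le_iff`). If `u` and `v` are independent and
uniform, so is `z` (`pairMeasure_subBorrow`). This expresses `c_∞` and `c_1` as the functions
`infCorr` and `oneCorr` defined by coin tossing, which make sense for all `α ∈ (0, 1/2]` and are
jointly continuous in `(α, ε)` because the laws involved have no atoms.

Splitting off the first digit gives self-similarity: `c_∞(α, α ε) = c_∞(α, ε) / 2` for `ε ≤ 1`,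
while `c_1(α, α ε) ≥ c_1(α, ε) / 2`, with equality when `α ε` is below the gap `1 - 2 α` between the
two halves of the Cantor set. So the determinism `detRatio` decreases along `ε, α ε, α² ε, …`
(`detRatio_mul_le`) and is eventually periodic (`detRatio_mul`). Its upper and lower limits are
therefore the maximum and the minimum over `[δ/4, δ]` for every small `δ`, uniformly for `α` in a
compact subinterval of `[1/4, 1/2)`, and they depend continuously on `α`.

It remains to find the values at the ends of the parameter interval and to apply the intermediate
value theorem. At `α = 1/4` the determinism is `1` at the radii `4⁻ⁿ` and at least `8/15` everywhere
(`detRatio_quarter_pow`, `le_detRatio_quarter`). At `α = 1/2` the law of `κ` is uniform on `[0, 1]`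
and `c_1(1/2, ε) = 2 ε - ε²`; the determinism is at most `1 / (2 - ε)` (`detRatio_half_le`) and
tends to `1/3` along `ε = 3/4 * 2⁻ᵏ` (`detRatio_half_eq`). By continuity and monotonicity along the orbit
of scales, these bounds pass to parameters slightly below `1/2`.
-/

/-! ### Binary sequences as 2-adic integers -/

/-- Prepend a bit to a binary sequence. -/
def consBit (b : Bool) (w : ℕ → Bool) : ℕ → Bool
  | 0 => b
  | n + 1 => w n

/-- Drop the first bit of a binary sequence. -/
def tailBits (u : ℕ → Bool) : ℕ → Bool := fun n => u (n + 1)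

/-- The digits of `u + c`, where `u` is the 2-adic integer `∑ uᵢ 2ⁱ` and `c` is a carry bit. -/
def addCarry : Bool → (ℕ → Bool) → ℕ → Bool
  | c, u, 0 => xor c (u 0)
  | c, u, n + 1 => addCarry (c && u 0) (tailBits u) n

/-- The odometer `u ↦ u + 1` on the 2-adic integers. -/
def odometer (u : ℕ → Bool) : ℕ → Bool := addCarry true u

/-- The borrow generated by the digit subtraction `y - x - b`. -/
def borrow (b x y : Bool) : Bool := if y then x && b else x || b

/-- The digits of `v - u - b`, where `u` and `v` are 2-adic integers and `b` is a borrow bit. -/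
def subBorrow : Bool → (ℕ → Bool) → (ℕ → Bool) → ℕ → Bool
  | b, u, v, 0 => xor b (xor (u 0) (v 0))
  | b, u, v, n + 1 => subBorrow (borrow b (u 0) (v 0)) (tailBits u) (tailBits v) n

/-- The digits of the 2-adic integer `-z`. -/
def negBits (z : ℕ → Bool) : ℕ → Bool := subBorrow false z fun _ => false

@[simp] theorem consBit_zero (b : Bool) (w : ℕ → Bool) : consBit b w 0 = b := rfl

@[simp] theorem consBit_succ (b : Bool) (w : ℕ → Bool) (n : ℕ) : consBit b w (n + 1) = w n := rfl

@[simp] theorem tailBits_consBit (b : Bool) (w : ℕ → Bool) : tailBits (consBit b w) = w := rfl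

theorem consBit_tailBits (u : ℕ → Bool) : consBit (u 0) (tailBits u) = u := by
  funext n; cases n <;> rfl

theorem tailBits_addCarry (c : Bool) (u : ℕ → Bool) :
    tailBits (addCarry c u) = addCarry (c && u 0) (tailBits u) := rfl

theorem tailBits_subBorrow (b : Bool) (u v : ℕ → Bool) :
    tailBits (subBorrow b u v) = subBorrow (borrow b (u 0) (v 0)) (tailBits u) (tailBits v) := rfl

theorem addCarry_false (u : ℕ → Bool) : addCarry false u = u := by
  funext n
  induction n generalizing u with
  | zero => simp [addCarry]
  | succ n ih => simp [addCarry, ih, tailBits]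

/-- `(v + d) - (u + c) - b = v - u - b'` as soon as `b + c = b' + d`. -/
theorem subBorrow_addCarry (n : ℕ) (b b' c d : Bool) (u v : ℕ → Bool)
    (h : b.toNat + c.toNat = b'.toNat + d.toNat) :
    subBorrow b (addCarry c u) (addCarry d v) n = subBorrow b' u v n := by
  induction n generalizing b b' c d u v with
  | zero =>
    simp only [subBorrow, addCarry]
    cases b <;> cases b' <;> cases c <;> cases d <;> simp_all
  | succ n ih =>
    simp only [subBorrow, tailBits_addCarry, addCarry]
    apply ih
    revert h
    generalize u 0 = x
    generalize v 0 = y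
    revert b b' c d x y
    decide

theorem subBorrow_odometer (u v : ℕ → Bool) :
    subBorrow false (odometer u) (odometer v) = subBorrow false u v :=
  funext fun n => subBorrow_addCarry n _ _ _ _ _ _ rfl

theorem subBorrow_odometer_iterate (u v : ℕ → Bool) (i : ℕ) :
    subBorrow false (odometer^[i] u) (odometer^[i] v) = subBorrow false u v := by
  induction i with
  | zero => rfl
  | succ i ih => rw [Function.iterate_succ_apply', Function.iterate_succ_apply',
      subBorrow_odometer, ih]

/-- `u - v - c = -(v - u - b) - b'` as soon as `b' = b + c`. -/
theorem subBorrow_swap_aux (n : ℕ) (b b' c : Bool) (u v : ℕ → Bool)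
    (h : b'.toNat = b.toNat + c.toNat) :
    subBorrow c v u n = subBorrow b' (subBorrow b u v) (fun _ => false) n := by
  induction n generalizing b b' c u v with
  | zero =>
    simp only [subBorrow]
    cases b <;> cases b' <;> cases c <;> cases u 0 <;> cases v 0 <;> simp_all
  | succ n ih =>
    rw [subBorrow, subBorrow, tailBits_subBorrow]
    apply ih
    revert h
    simp only [subBorrow]
    generalize u 0 = x
    generalize v 0 = y
    revert b b' c x y
    decide

theorem subBorrow_swap (u v : ℕ → Bool) :
    subBorrow false v u = negBits (subBorrow false u v) :=
  funext fun n => subBorrow_swap_aux n false false false u v rfl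

/-- Subtracting a sequence that starts with `n` zeros does not change the first `n` digits. -/
theorem subBorrow_of_zero {n : ℕ} {u v : ℕ → Bool} (h : ∀ j < n, u j = false) :
    ∀ j < n, subBorrow false u v j = v j := by
  intro j hj
  induction j generalizing n u v with
  | zero => simp [subBorrow, h 0 hj]
  | succ j ih =>
    have h0 : borrow false (u 0) (v 0) = false := by
      rw [h 0 (by omega)]; cases v 0 <;> rfl
    rw [subBorrow, h0]
    exact ih (n := n - 1) (fun i hi => h (i + 1) (by omega)) (by omega)

theorem odometer_consBit_false (w : ℕ → Bool) : odometer (consBit false w) = consBit true w := by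
  funext n
  cases n with
  | zero => rfl
  | succ n => simp [odometer, addCarry, addCarry_false]

theorem odometer_consBit_true (w : ℕ → Bool) :
    odometer (consBit true w) = consBit false (odometer w) := by
  funext n
  cases n with
  | zero => rfl
  | succ n => simp [odometer, addCarry]

theorem odometer_iterate_consBit_false (w : ℕ → Bool) (i : ℕ) :
    odometer^[2 * i] (consBit false w) = consBit false (odometer^[i] w) := by
  induction i with
  | zero => rfl
  | succ i ih =>
    rw [show 2 * (i + 1) = 2 * i + 1 + 1 by ring, Function.iterate_succ_apply',
      Function.iterate_succ_apply', Function.iterate_succ_apply', ih, odometer_consBit_false,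
      odometer_consBit_true]

/-- Every orbit of the odometer comes arbitrarily close to `0`. -/
theorem exists_odometer_iterate_zero (n : ℕ) (u : ℕ → Bool) :
    ∃ i, ∀ j < n, (odometer^[i] u) j = false := by
  induction n generalizing u with
  | zero => exact ⟨0, by simp⟩
  | succ n ih =>
    have key : ∀ w, ∃ i, ∀ j < n + 1, (odometer^[i] (consBit false w)) j = false := by
      intro w
      obtain ⟨i, hi⟩ := ih w
      refine ⟨2 * i, fun j hj => ?_⟩
      rw [odometer_iterate_consBit_false]
      cases j with
      | zero => rfl
      | succ j => exact hi j (by omega)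
    rw [← consBit_tailBits u]
    cases u 0 with
    | false => exact key _
    | true =>
      obtain ⟨i, hi⟩ := key (odometer (tailBits u))
      refine ⟨i + 1, ?_⟩
      rwa [Function.iterate_succ_apply, odometer_consBit_true]

theorem negBits_consBit_false (w : ℕ → Bool) :
    negBits (consBit false w) = consBit false (negBits w) := by
  funext n
  cases n <;> rfl

theorem subBorrow_true_zero (w : ℕ → Bool) :
    subBorrow true w (fun _ => false) = fun n => !w n := by
  funext n
  induction n generalizing w with
  | zero => simp [subBorrow]
  | succ n ih =>
    have h : borrow true (w 0) false = true := by cases w 0 <;> rfl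
    rw [subBorrow, h]
    exact ih _

theorem negBits_consBit_true (w : ℕ → Bool) :
    negBits (consBit true w) = consBit true fun n => !w n := by
  rw [← subBorrow_true_zero]
  funext n
  cases n <;> rfl

/-! ### The coding map -/

theorem kappa_term_mem {α : ℝ} (hα : α ∈ Icc (0 : ℝ) (1 / 2)) (b : Bool) (i : ℕ) :
    0 ≤ (if b then (1 : ℝ) else 0) * α ^ i ∧
      (if b then (1 : ℝ) else 0) * α ^ i ≤ (1 / 2 : ℝ) ^ i := by
  have h0 : 0 ≤ α ^ i := pow_nonneg hα.1 i
  have h1 : α ^ i ≤ (1 / 2 : ℝ) ^ i := pow_le_pow_left₀ hα.1 hα.2 i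
  cases b
  · simp
  · simpa only [if_true, one_mul] using And.intro h0 h1

theorem summable_half_pow : Summable fun i : ℕ => (1 / 2 : ℝ) ^ i :=
  summable_geometric_of_lt_one (by norm_num) (by norm_num)

/-- The coding map is jointly continuous in the parameter `α ∈ [0, 1/2]` and the sequence. -/
theorem continuousOn_kappa :
    ContinuousOn (fun p : ℝ × (ℕ → Bool) => kappa p.1 p.2) (Icc (0 : ℝ) (1 / 2) ×ˢ univ) := by
  unfold kappa
  refine (by fun_prop : Continuous fun p : ℝ × (ℕ → Bool) => 1 - p.1).continuousOn.mul
    (continuousOn_tsum (u := fun i => (1 / 2 : ℝ) ^ i) (fun i => ?_) summable_half_pow ?_)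
  · refine Continuous.continuousOn (Continuous.mul ?_ (by fun_prop))
    exact (continuous_of_discreteTopology (f := fun b : Bool => if b then (1 : ℝ) else 0)).comp
      ((continuous_apply i).comp continuous_snd)
  · intro i p hp
    have := kappa_term_mem hp.1 (p.2 i) i
    rw [Real.norm_eq_abs, abs_of_nonneg this.1]
    exact this.2

theorem continuousOn_kappa_left (u : ℕ → Bool) :
    ContinuousOn (fun α => kappa α u) (Icc (0 : ℝ) (1 / 2)) :=
  continuousOn_kappa.comp (f := fun α => (α, u)) (by fun_prop) fun _ h => ⟨h, mem_univ _⟩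

theorem measurable_kappa_of_mem {α : ℝ} (hα : α ∈ Ioc (0 : ℝ) (1 / 2)) : Measurable (kappa α) := by
  have : ContinuousOn (kappa α) univ :=
    continuousOn_kappa.comp (f := fun u => (α, u)) (by fun_prop)
      fun _ _ => ⟨⟨hα.1.le, hα.2⟩, mem_univ _⟩
  exact (continuousOn_univ.1 this).measurable

theorem kappa_consBit {α : ℝ} (hα : α ∈ Ioc (0 : ℝ) (1 / 2)) (b : Bool) (w : ℕ → Bool) :
    kappa α (consBit b w) = (1 - α) * (if b then 1 else 0) + α * kappa α w := by
  have hs : Summable fun i : ℕ => (if consBit b w i then (1 : ℝ) else 0) * α ^ i :=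
    Summable.of_nonneg_of_le (fun i => (kappa_term_mem ⟨hα.1.le, hα.2⟩ _ i).1)
      (fun i => (kappa_term_mem ⟨hα.1.le, hα.2⟩ _ i).2) summable_half_pow
  have h : ∑' i : ℕ, (if consBit b w (i + 1) then (1 : ℝ) else 0) * α ^ (i + 1) =
      α * ∑' i : ℕ, (if w i then (1 : ℝ) else 0) * α ^ i := by
    rw [← tsum_mul_left]
    exact tsum_congr fun i => by rw [consBit_succ]; ring
  unfold kappa
  rw [hs.tsum_eq_zero_add, h, consBit_zero]
  ring

theorem kappa_consBit_false {α : ℝ} (hα : α ∈ Ioc (0 : ℝ) (1 / 2)) (w : ℕ → Bool) :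
    kappa α (consBit false w) = α * kappa α w := by
  rw [kappa_consBit hα]; simp

theorem kappa_consBit_true {α : ℝ} (hα : α ∈ Ioc (0 : ℝ) (1 / 2)) (w : ℕ → Bool) :
    kappa α (consBit true w) = 1 - α + α * kappa α w := by
  rw [kappa_consBit hα]; simp

theorem kappa_eq_tail {α : ℝ} (hα : α ∈ Ioc (0 : ℝ) (1 / 2)) (u : ℕ → Bool) :
    kappa α u = (1 - α) * (if u 0 then 1 else 0) + α * kappa α (tailBits u) := by
  rw [← kappa_consBit hα, consBit_tailBits]

theorem kappa_true {α : ℝ} (hα : α ∈ Ioc (0 : ℝ) (1 / 2)) : kappa α (fun _ => true) = 1 := by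
  have h := kappa_eq_tail hα fun _ => true
  have h1 : tailBits (fun _ => true) = fun _ => true := rfl
  rw [h1] at h
  simp only [if_true] at h
  have h2 : (1 - α) * (kappa α (fun _ => true) - 1) = 0 := by linarith
  rcases mul_eq_zero.1 h2 with h3 | h3 <;> linarith [hα.2]

/-- Complementing all the bits reflects the Cantor set. -/
theorem kappa_not {α : ℝ} (hα : α ∈ Ioc (0 : ℝ) (1 / 2)) (u : ℕ → Bool) :
    kappa α (fun n => !u n) = 1 - kappa α u := by
  have hs : ∀ w : ℕ → Bool, Summable fun i : ℕ => (if w i then (1 : ℝ) else 0) * α ^ i := fun w =>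
    Summable.of_nonneg_of_le (fun i => (kappa_term_mem ⟨hα.1.le, hα.2⟩ _ i).1)
      (fun i => (kappa_term_mem ⟨hα.1.le, hα.2⟩ _ i).2) summable_half_pow
  rw [eq_sub_iff_add_eq, ← kappa_true hα]
  unfold kappa
  rw [← mul_add, ← (hs _).tsum_add (hs _)]
  congr 2
  funext i
  cases u i <;> simp

theorem kappa_nonneg {α : ℝ} (hα : α ∈ Ioc (0 : ℝ) (1 / 2)) (u : ℕ → Bool) : 0 ≤ kappa α u :=
  mul_nonneg (by linarith [hα.2])
    (tsum_nonneg fun i => (kappa_term_mem ⟨hα.1.le, hα.2⟩ (u i) i).1)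

theorem kappa_le_one {α : ℝ} (hα : α ∈ Ioc (0 : ℝ) (1 / 2)) (u : ℕ → Bool) : kappa α u ≤ 1 := by
  linarith [kappa_not hα u, kappa_nonneg hα fun n => !u n]

theorem abs_kappa_sub_le {α : ℝ} (hα : α ∈ Ioc (0 : ℝ) (1 / 2)) {n : ℕ} {u v : ℕ → Bool}
    (h : ∀ j < n, u j = v j) : |kappa α u - kappa α v| ≤ α ^ n := by
  induction n generalizing u v with
  | zero =>
    rw [abs_le, pow_zero]
    constructor <;> linarith [kappa_nonneg hα u, kappa_nonneg hα v, kappa_le_one hα u,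
      kappa_le_one hα v]
  | succ n ih =>
    rw [kappa_eq_tail hα u, kappa_eq_tail hα v, h 0 (by omega), add_sub_add_left_eq_sub, ← mul_sub,
      abs_mul, abs_of_pos hα.1, pow_succ']
    exact mul_le_mul_of_nonneg_left (ih fun j hj => h (j + 1) (by omega)) hα.1.le

/-- Subadditivity of the coding map with an explicit error after `n` digits: a carry replaces
`2 αⁱ` by the smaller quantity `αⁱ⁺¹`. -/
theorem kappa_sub_le_aux {α : ℝ} (hα : α ∈ Ioc (0 : ℝ) (1 / 2)) (n : ℕ) (b : Bool)
    (u v : ℕ → Bool) : kappa α v - kappa α u - kappa α (subBorrow b u v) ≤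
      (1 - α) * (if b then 1 else 0) + α ^ n := by
  obtain ⟨h0, h1⟩ := id hα
  induction n generalizing b u v with
  | zero =>
    have : 0 ≤ (1 - α) * (if b then 1 else 0) := by split_ifs <;> linarith
    linarith [kappa_nonneg hα u, kappa_nonneg hα (subBorrow b u v), kappa_le_one hα v]
  | succ n ih =>
    have ih' := mul_le_mul_of_nonneg_left
      (ih (borrow b (u 0) (v 0)) (tailBits u) (tailBits v)) h0.le
    rw [kappa_eq_tail hα u, kappa_eq_tail hα v, kappa_eq_tail hα (subBorrow b u v),
      tailBits_subBorrow, subBorrow, pow_succ']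
    revert ih'
    generalize kappa α (subBorrow (borrow b (u 0) (v 0)) (tailBits u) (tailBits v)) = z
    cases b <;> cases u 0 <;> cases v 0 <;> simp [borrow] <;> intro ih' <;> nlinarith

theorem tendsto_pow_of_mem {α : ℝ} (hα : α ∈ Ioc (0 : ℝ) (1 / 2)) :
    Tendsto (fun n : ℕ => α ^ n) atTop (𝓝 0) :=
  tendsto_pow_atTop_nhds_zero_of_lt_one hα.1.le (by linarith [hα.2])

theorem kappa_sub_le {α : ℝ} (hα : α ∈ Ioc (0 : ℝ) (1 / 2)) (u v : ℕ → Bool) :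
    kappa α v - kappa α u ≤ kappa α (subBorrow false u v) := by
  have h : kappa α v - kappa α u - kappa α (subBorrow false u v) ≤ 0 :=
    ge_of_tendsto' (tendsto_pow_of_mem hα) fun n => by
      simpa using kappa_sub_le_aux hα n false u v
  linarith

/-- Along the orbit of a pair the signed distance approaches the code of the difference, because
the orbit of the first point approaches `0`. -/
theorem kappa_subBorrow_le {α ε : ℝ} (hα : α ∈ Ioc (0 : ℝ) (1 / 2)) {u v : ℕ → Bool}
    (h : ∀ i, kappa α (odometer^[i] v) - kappa α (odometer^[i] u) ≤ ε) :
    kappa α (subBorrow false u v) ≤ ε := by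
  have hlim : Tendsto (fun n : ℕ => ε + (α ^ n + α ^ n)) atTop (𝓝 ε) := by
    simpa using ((tendsto_pow_of_mem hα).add (tendsto_pow_of_mem hα)).const_add ε
  refine ge_of_tendsto' hlim fun n => ?_
  obtain ⟨i, hi⟩ := exists_odometer_iterate_zero n u
  have h1 := abs_kappa_sub_le hα (subBorrow_of_zero (v := odometer^[i] v) hi)
  rw [subBorrow_odometer_iterate] at h1
  have h2 := abs_kappa_sub_le hα (v := fun _ => false) hi
  have h3 : kappa α (fun _ => false) = 0 := by simp [kappa]
  rw [h3] at h2
  linarith [(abs_le.1 h1).2, (abs_le.1 h2).2, h i]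

/-- The supremum of the distances along the orbits of `u` and `v` under the odometer is
`max (κ (v - u)) (κ (u - v))`. -/
theorem forall_abs_kappa_odometer_le_iff {α ε : ℝ} (hα : α ∈ Ioc (0 : ℝ) (1 / 2))
    (u v : ℕ → Bool) :
    (∀ i, |kappa α (odometer^[i] u) - kappa α (odometer^[i] v)| ≤ ε) ↔
      max (kappa α (subBorrow false u v)) (kappa α (negBits (subBorrow false u v))) ≤ ε := by
  rw [max_le_iff, ← subBorrow_swap]
  constructor
  · intro h
    exact ⟨kappa_subBorrow_le hα fun i => by linarith [(abs_le.1 (h i)).1],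
      kappa_subBorrow_le hα fun i => by linarith [(abs_le.1 (h i)).2]⟩
  · rintro ⟨h1, h2⟩ i
    have a1 := kappa_sub_le hα (odometer^[i] u) (odometer^[i] v)
    have a2 := kappa_sub_le hα (odometer^[i] v) (odometer^[i] u)
    rw [subBorrow_odometer_iterate] at a1 a2
    exact abs_le.2 ⟨by linarith, by linarith⟩

/-! ### The map `f_α` is an odometer on the Cantor set -/

theorem kappa_of_first_false {α : ℝ} (hα : α ∈ Ioc (0 : ℝ) (1 / 2)) {n : ℕ} {u : ℕ → Bool}
    (h1 : ∀ i < n, u i = true) (h2 : u n = false) :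
    ∃ t ∈ Icc (0 : ℝ) 1, kappa α u = 1 - α ^ n + α ^ (n + 1) * t ∧
      kappa α (odometer u) = α ^ n * (1 - α) + α ^ (n + 1) * t := by
  induction n generalizing u with
  | zero =>
    refine ⟨kappa α (tailBits u), ⟨kappa_nonneg hα _, kappa_le_one hα _⟩, ?_, ?_⟩
    · rw [kappa_eq_tail hα, h2]; simp
    · rw [← consBit_tailBits u, h2, odometer_consBit_false, kappa_consBit_true hα]; simp
  | succ n ih =>
    obtain ⟨t, ht, e1, e2⟩ := ih (u := tailBits u) (fun i hi => h1 (i + 1) (by omega)) h2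
    refine ⟨t, ht, ?_, ?_⟩
    · rw [kappa_eq_tail hα, h1 0 (by omega), e1]; simp; ring
    · rw [← consBit_tailBits u, h1 0 (by omega), odometer_consBit_true, kappa_consBit_false hα, e2]
      ring

theorem odometer_true : odometer (fun _ => true) = fun _ => false := by
  funext n
  induction n with
  | zero => rfl
  | succ n ih => exact ih

/-- The coding map conjugates the odometer to `f_α`. -/
theorem delahaye_kappa {α : ℝ} (hα : α ∈ Ioo (0 : ℝ) (1 / 2)) (u : ℕ → Bool) :
    delahaye α (kappa α u) = kappa α (odometer u) := by
  classical
  have hα' : α ∈ Ioc (0 : ℝ) (1 / 2) := ⟨hα.1, hα.2.le⟩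
  by_cases h : ∃ n, u n = false
  · obtain ⟨t, ht, e1, e2⟩ := kappa_of_first_false hα'
      (fun i hi => by simpa using Nat.find_min h hi) (Nat.find_spec h)
    set n := Nat.find h
    have hp : 0 < α ^ (n + 1) := pow_pos hα.1 _
    rw [delahaye_of_mem_Icc hα (j := n + 1) (by omega), e1, e2, Nat.add_sub_cancel]
    · ring
    · rw [e1, Nat.add_sub_cancel]
      constructor <;> nlinarith [ht.1, ht.2]
  · have hu : u = fun _ => true := by
      funext n
      by_contra hn
      exact h ⟨n, by simpa using hn⟩
    rw [hu, odometer_true, kappa_true hα', delahaye_one hα]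
    simp [kappa]

theorem delahaye_iterate_kappa {α : ℝ} (hα : α ∈ Ioo (0 : ℝ) (1 / 2)) (u : ℕ → Bool) (i : ℕ) :
    (delahaye α)^[i] (kappa α u) = kappa α (odometer^[i] u) := by
  induction i with
  | zero => rfl
  | succ i ih => rw [Function.iterate_succ_apply', Function.iterate_succ_apply', ih,
      delahaye_kappa hα]

theorem kappa_injective {α : ℝ} (hα : α ∈ Ioo (0 : ℝ) (1 / 2)) :
    Function.Injective (kappa α) := by
  intro u v h
  funext n
  have h1 := (kappa_mem_wordInterval hα (k := n + 1) (fun i => v i) v).2 fun _ => rfl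
  rw [← h, kappa_mem_wordInterval hα] at h1
  exact h1 ⟨n, by omega⟩

/-! ### Self-similarity of the coin-tossing measure -/

theorem measurableSet_prefix (k : ℕ) (w : ℕ → Bool) :
    MeasurableSet {v : ℕ → Bool | ∀ i < k, v i = w i} := by
  have : {v : ℕ → Bool | ∀ i < k, v i = w i} = ⋂ i, ⋂ _ : i < k, {v | v i = w i} := by
    ext; simp
  rw [this]
  exact MeasurableSet.iInter fun i => MeasurableSet.iInter fun _ =>
    measurableSet_eq_fun (measurable_pi_apply i) measurable_const

theorem generateFrom_prefix : (MeasurableSpace.pi : MeasurableSpace (ℕ → Bool)) =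
    MeasurableSpace.generateFrom
      {s | ∃ (k : ℕ) (w : ℕ → Bool), s = {v : ℕ → Bool | ∀ i < k, v i = w i}} := by
  apply le_antisymm
  · refine iSup_le fun i => measurable_iff_comap_le.1 ?_
    refine @measurable_to_countable' _ _ _ _ (_) _ fun b => ?_
    have : (fun v : ℕ → Bool => v i) ⁻¹' {b} = ⋃ w : Fin i → Bool, {v | ∀ j < i + 1,
        v j = (fun n => if h : n < i then w ⟨n, h⟩ else b) j} := by
      ext v
      simp only [mem_preimage, mem_singleton_iff, mem_iUnion, mem_ofPred_eq]
      constructor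
      · rintro rfl
        refine ⟨fun j => v j, fun j hj => ?_⟩
        split_ifs with h
        · rfl
        · rw [show j = i by omega]
      · rintro ⟨w, hw⟩
        simpa using hw i (by omega)
    rw [this]
    exact @MeasurableSet.iUnion _ _ (_) _ _ fun w => MeasurableSpace.measurableSet_generateFrom
      ⟨i + 1, _, rfl⟩
  · refine MeasurableSpace.generateFrom_le ?_
    rintro _ ⟨k, w, rfl⟩
    exact measurableSet_prefix k w

theorem coinMeasure_prefix (k : ℕ) (w : ℕ → Bool) :
    coinMeasure {v | ∀ i < k, v i = w i} = 2⁻¹ ^ k := by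
  have hset : {v : ℕ → Bool | ∀ i < k, v i = w i} =
      Set.pi (Finset.range k) fun i => {w i} := by
    ext v; simp
  rw [hset, coinMeasure, Measure.infinitePi_pi _ (fun i _ => MeasurableSet.of_discrete),
    Finset.prod_congr rfl (g := fun _ => (2⁻¹ : ENNReal)), Finset.prod_const, Finset.card_range]
  intro i _
  rw [uniformOn_univ]
  simp

/-- The coin-tossing measure is characterized by its values on prefix sets. -/
theorem eq_coinMeasure {μ : Measure (ℕ → Bool)}
    (h : ∀ (k : ℕ) (w : ℕ → Bool), μ {v | ∀ i < k, v i = w i} = 2⁻¹ ^ k) : μ = coinMeasure := by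
  symm
  refine ext_of_generate_finite _ generateFrom_prefix ?_ ?_ ?_
  · rintro _ ⟨k, w, rfl⟩ _ ⟨l, x, rfl⟩ ⟨y, hy1, hy2⟩
    refine ⟨max k l, y, ?_⟩
    ext v
    simp only [mem_inter_iff, mem_ofPred_eq] at hy1 hy2 ⊢
    constructor
    · rintro ⟨h1, h2⟩ i hi
      rcases lt_max_iff.1 hi with hi | hi
      · rw [h1 i hi, hy1 i hi]
      · rw [h2 i hi, hy2 i hi]
    · intro h
      exact ⟨fun i hi => by rw [h i (lt_max_of_lt_left hi), hy1 i hi],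
        fun i hi => by rw [h i (lt_max_of_lt_right hi), hy2 i hi]⟩
  · rintro _ ⟨k, w, rfl⟩
    rw [h, coinMeasure_prefix]
  · have h0 := h 0 fun _ => false
    have h1 := coinMeasure_prefix 0 fun _ => false
    simp only [not_lt_zero, false_imp_iff, implies_true, ofPred_true, pow_zero] at h0 h1
    rw [h0, h1]

theorem measurable_consBit (b : Bool) : Measurable (consBit b) := by
  refine measurable_pi_lambda _ fun n => ?_
  cases n with
  | zero => exact measurable_const
  | succ n => exact measurable_pi_apply n

theorem coinMeasure_eq_add : coinMeasure =
    (2⁻¹ : ENNReal) • (coinMeasure.map (consBit false) + coinMeasure.map (consBit true)) := by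
  symm
  refine eq_coinMeasure fun k w => ?_
  rw [Measure.smul_apply, Measure.add_apply,
    Measure.map_apply (measurable_consBit _) (measurableSet_prefix k w),
    Measure.map_apply (measurable_consBit _) (measurableSet_prefix k w), smul_eq_mul]
  cases k with
  | zero => simp [ENNReal.inv_two_add_inv_two, mul_add]
  | succ k =>
    have key : ∀ b, consBit b ⁻¹' {v | ∀ i < k + 1, v i = w i} =
        if b = w 0 then {v | ∀ i < k, v i = tailBits w i} else ∅ := by
      intro b
      ext v
      split_ifs with hb
      · simp only [mem_preimage, mem_ofPred_eq]
        exact ⟨fun h i hi => h (i + 1) (by omega), fun h i hi => by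
          cases i with
          | zero => exact hb
          | succ i => exact h i (by omega)⟩
      · simp only [mem_preimage, mem_ofPred_eq, mem_empty_iff_false, iff_false]
        exact fun h => hb (h 0 (by omega))
    rw [key, key, pow_succ']
    cases w 0 <;> simp [coinMeasure_prefix]

theorem coinMeasure_apply {A : Set (ℕ → Bool)} (hA : MeasurableSet A) :
    coinMeasure A =
      2⁻¹ * (coinMeasure (consBit false ⁻¹' A) + coinMeasure (consBit true ⁻¹' A)) := by
  conv_lhs => rw [coinMeasure_eq_add]
  rw [Measure.smul_apply, Measure.add_apply, Measure.map_apply (measurable_consBit _) hA,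
    Measure.map_apply (measurable_consBit _) hA, smul_eq_mul]

theorem coinMeasure_real {A : Set (ℕ → Bool)} (hA : MeasurableSet A) :
    coinMeasure.real A = 1 / 2 * coinMeasure.real (consBit false ⁻¹' A) +
      1 / 2 * coinMeasure.real (consBit true ⁻¹' A) := by
  rw [measureReal_def, coinMeasure_apply hA, ENNReal.toReal_mul,
    ENNReal.toReal_add (by finiteness) (by finiteness)]
  simp [measureReal_def]
  ring

/-- The law of a pair of independent coin-tossing sequences. -/
noncomputable abbrev pairMeasure : Measure ((ℕ → Bool) × (ℕ → Bool)) :=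
  coinMeasure.prod coinMeasure

theorem pairMeasure_real {A : Set ((ℕ → Bool) × (ℕ → Bool))} (hA : MeasurableSet A) :
    pairMeasure.real A =
      1 / 4 * pairMeasure.real (Prod.map (consBit false) (consBit false) ⁻¹' A) +
      1 / 4 * pairMeasure.real (Prod.map (consBit false) (consBit true) ⁻¹' A) +
      1 / 4 * pairMeasure.real (Prod.map (consBit true) (consBit false) ⁻¹' A) +
      1 / 4 * pairMeasure.real (Prod.map (consBit true) (consBit true) ⁻¹' A) := by
  have h : pairMeasure A = 2⁻¹ * (2⁻¹ *
      (pairMeasure (Prod.map (consBit false) (consBit false) ⁻¹' A) +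
      pairMeasure (Prod.map (consBit false) (consBit true) ⁻¹' A) +
      (pairMeasure (Prod.map (consBit true) (consBit false) ⁻¹' A) +
      pairMeasure (Prod.map (consBit true) (consBit true) ⁻¹' A)))) := by
    have e : ∀ a b, pairMeasure (Prod.map (consBit a) (consBit b) ⁻¹' A) =
        (coinMeasure.map (consBit a)).prod (coinMeasure.map (consBit b)) A := by
      intro a b
      rw [Measure.map_prod_map _ _ (measurable_consBit a) (measurable_consBit b),
        Measure.map_apply ((measurable_consBit a).prodMap (measurable_consBit b)) hA]
    simp only [e]
    conv_lhs => rw [pairMeasure, coinMeasure_eq_add]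
    have : ∀ b, IsProbabilityMeasure (coinMeasure.map (consBit b)) := fun b =>
      Measure.isProbabilityMeasure_map (measurable_consBit b).aemeasurable
    rw [Measure.prod_smul_left, Measure.prod_smul_right, Measure.add_prod, Measure.prod_add,
      Measure.prod_add]
    simp only [Measure.smul_apply, Measure.add_apply, smul_eq_mul]
  simp only [measureReal_def]
  rw [h]
  simp only [ENNReal.toReal_mul, ENNReal.toReal_inv, ENNReal.toReal_ofNat]
  rw [ENNReal.toReal_add (by finiteness) (by finiteness),
    ENNReal.toReal_add (by finiteness) (by finiteness),
    ENNReal.toReal_add (by finiteness) (by finiteness)]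
  ring

/-! ### The difference of two independent uniform 2-adic integers is uniform -/

theorem measurable_subBorrow_aux (n : ℕ) :
    Measurable fun q : Bool × (ℕ → Bool) × (ℕ → Bool) => subBorrow q.1 q.2.1 q.2.2 n := by
  induction n with
  | zero =>
    have h : Measurable fun r : Bool × Bool × Bool => xor r.1 (xor r.2.1 r.2.2) :=
      Measurable.of_discrete
    exact h.comp (g := fun r : Bool × Bool × Bool => xor r.1 (xor r.2.1 r.2.2))
      (f := fun q : Bool × (ℕ → Bool) × (ℕ → Bool) => (q.1, q.2.1 0, q.2.2 0)) (by fun_prop)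
  | succ n ih =>
    have h : Measurable fun r : Bool × Bool × Bool => borrow r.1 r.2.1 r.2.2 :=
      Measurable.of_discrete
    have h1 : Measurable fun q : Bool × (ℕ → Bool) × (ℕ → Bool) =>
        borrow q.1 (q.2.1 0) (q.2.2 0) :=
      h.comp (f := fun q : Bool × (ℕ → Bool) × (ℕ → Bool) => (q.1, q.2.1 0, q.2.2 0))
        (by fun_prop)
    have h2 : Measurable tailBits :=
      measurable_pi_lambda _ fun n => measurable_pi_apply (n + 1)
    exact ih.comp (h1.prodMk ((h2.comp (measurable_fst.comp measurable_snd)).prodMk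
      (h2.comp (measurable_snd.comp measurable_snd))))

theorem measurable_subBorrow :
    Measurable fun p : (ℕ → Bool) × (ℕ → Bool) => subBorrow false p.1 p.2 :=
  measurable_pi_lambda _ fun n =>
    (measurable_subBorrow_aux n).comp (measurable_const.prodMk measurable_id)

theorem measurable_subBorrow_right (b : Bool) (u : ℕ → Bool) : Measurable (subBorrow b u) :=
  measurable_pi_lambda _ fun n =>
    (measurable_subBorrow_aux n).comp
      (measurable_const.prodMk (measurable_const.prodMk measurable_id))

theorem measurable_negBits : Measurable negBits :=
  measurable_subBorrow.comp (measurable_id.prodMk measurable_const)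

/-- For fixed `u` the map `v ↦ v - u - b` preserves the coin-tossing measure: whatever the borrow,
exactly one value of each digit of `v` produces the prescribed digit of the difference. -/
theorem coinMeasure_subBorrow_prefix (k : ℕ) (b : Bool) (u w : ℕ → Bool) :
    coinMeasure {v | ∀ i < k, subBorrow b u v i = w i} = 2⁻¹ ^ k := by
  induction k generalizing b u w with
  | zero => simp
  | succ k ih =>
    have key : ∀ x, consBit x ⁻¹' {v | ∀ i < k + 1, subBorrow b u v i = w i} =
        if xor b (xor (u 0) x) = w 0 then
          {v | ∀ i < k, subBorrow (borrow b (u 0) x) (tailBits u) v i = tailBits w i} else ∅ := by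
      intro x
      ext v
      split_ifs with hb
      · simp only [mem_preimage, mem_ofPred_eq]
        exact ⟨fun h i hi => h (i + 1) (by omega), fun h i hi => by
          cases i with
          | zero => exact hb
          | succ i => exact h i (by omega)⟩
      · simp only [mem_preimage, mem_ofPred_eq, mem_empty_iff_false, iff_false]
        exact fun h => hb (h 0 (by omega))
    have hm : MeasurableSet {v | ∀ i < k + 1, subBorrow b u v i = w i} :=
      measurable_subBorrow_right b u (measurableSet_prefix (k + 1) w)
    rw [coinMeasure_apply hm, key, key, pow_succ']
    cases b <;> cases u 0 <;> cases w 0 <;> simp [ih]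

theorem map_subBorrow (u : ℕ → Bool) : coinMeasure.map (subBorrow false u) = coinMeasure := by
  refine eq_coinMeasure fun k w => ?_
  rw [Measure.map_apply (measurable_subBorrow_right false u) (measurableSet_prefix k w)]
  exact coinMeasure_subBorrow_prefix k false u w

/-- If `u` and `v` are independent and uniform, then `v - u` is uniform. -/
theorem pairMeasure_subBorrow {A : Set (ℕ → Bool)} (hA : MeasurableSet A) :
    pairMeasure {p | subBorrow false p.1 p.2 ∈ A} = coinMeasure A := by
  have hm : MeasurableSet {p : (ℕ → Bool) × (ℕ → Bool) | subBorrow false p.1 p.2 ∈ A} :=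
    measurable_subBorrow hA
  rw [pairMeasure, Measure.prod_apply hm]
  have : ∀ u : ℕ → Bool, coinMeasure (Prod.mk u ⁻¹' {p | subBorrow false p.1 p.2 ∈ A}) =
      coinMeasure A := by
    intro u
    conv_rhs => rw [← map_subBorrow u]
    rw [Measure.map_apply (measurable_subBorrow_right false u) hA]
    rfl
  simp only [this, lintegral_const, measure_univ, mul_one]

/-! ### Correlation integrals in terms of fair coins -/

/-- The distribution function of `κ_α` under the coin-tossing measure. -/
noncomputable def kappaCdf (α x : ℝ) : ℝ := coinMeasure.real {w | kappa α w ≤ x}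

/-- The quantity `max (κ z) (κ (-z))`. It is the supremum of `|κ(u + i) - κ(v + i)|` over all `i`
whenever `v - u = z`. -/
noncomputable def diffNorm (α : ℝ) (z : ℕ → Bool) : ℝ := max (kappa α z) (kappa α (negBits z))

/-- The correlation integral `c_∞(α, ε)`, expressed through the difference of two points, which is
uniformly distributed. Unlike the original, it makes sense also at `α = 1/2`. -/
noncomputable def infCorr (α ε : ℝ) : ℝ := coinMeasure.real {z | diffNorm α z ≤ ε}

/-- The correlation integral `c_1(α, ε)` as a probability for two independent coin-tossing
sequences. It makes sense also at `α = 1/2`. -/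
noncomputable def oneCorr (α ε : ℝ) : ℝ :=
  pairMeasure.real {p | |kappa α p.1 - kappa α p.2| ≤ ε}

theorem measurable_diffNorm {α : ℝ} (hα : α ∈ Ioc (0 : ℝ) (1 / 2)) : Measurable (diffNorm α) :=
  (measurable_kappa_of_mem hα).max ((measurable_kappa_of_mem hα).comp measurable_negBits)

theorem measurable_kappa_sub {α : ℝ} (hα : α ∈ Ioc (0 : ℝ) (1 / 2)) :
    Measurable fun p : (ℕ → Bool) × (ℕ → Bool) => kappa α p.1 - kappa α p.2 :=
  ((measurable_kappa_of_mem hα).comp measurable_fst).sub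
    ((measurable_kappa_of_mem hα).comp measurable_snd)

theorem abs_kappa_sub_le_one {α : ℝ} (hα : α ∈ Ioc (0 : ℝ) (1 / 2)) (u v : ℕ → Bool) :
    |kappa α u - kappa α v| ≤ 1 := by
  simpa using abs_kappa_sub_le hα (n := 0) (u := u) (v := v) (by simp)

theorem diffNorm_le_one {α : ℝ} (hα : α ∈ Ioc (0 : ℝ) (1 / 2)) (z : ℕ → Bool) :
    diffNorm α z ≤ 1 := max_le (kappa_le_one hα _) (kappa_le_one hα _)

/-- Transport of the correlation integral to the space of bits. The coding map is a closed
embedding for `α < 1/2`, so that no measurability of `f_α` is needed. -/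
theorem corrIntegral_delahaye {α : ℝ} (hα : α ∈ Ioo (0 : ℝ) (1 / 2)) (l : ℕ∞) (ε : ℝ) :
    corrIntegral (delahaye α) (muAlpha α) l ε = pairMeasure.real {p | orbitDist (delahaye α) l
      (kappa α p.1) (kappa α p.2) ≤ ENNReal.ofReal ε} := by
  have hemb : MeasurableEmbedding (Prod.map (kappa α) (kappa α)) :=
    (((continuous_kappa hα).prodMap (continuous_kappa hα)).isClosedEmbedding
      ((kappa_injective hα).prodMap (kappa_injective hα))).measurableEmbedding
  have : IsProbabilityMeasure (coinMeasure.map (kappa α)) := isProbabilityMeasure_muAlpha hα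
  rw [corrIntegral, muAlpha, Measure.map_prod_map _ _ (measurable_kappa hα) (measurable_kappa hα),
    measureReal_def, hemb.map_apply]
  rfl

theorem orbitDist_kappa_le_iff {α ε : ℝ} (hα : α ∈ Ioo (0 : ℝ) (1 / 2)) (hε : 0 ≤ ε) (l : ℕ∞)
    (u v : ℕ → Bool) :
    orbitDist (delahaye α) l (kappa α u) (kappa α v) ≤ ENNReal.ofReal ε ↔
      ∀ i : ℕ, (i : ℕ∞) < l → |kappa α (odometer^[i] u) - kappa α (odometer^[i] v)| ≤ ε := by
  simp only [orbitDist, iSup_le_iff, delahaye_iterate_kappa hα, edist_dist, Real.dist_eq,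
    ENNReal.ofReal_le_ofReal_iff hε]

theorem corrIntegral_one {α ε : ℝ} (hα : α ∈ Ioo (0 : ℝ) (1 / 2)) (hε : 0 ≤ ε) :
    corrIntegral (delahaye α) (muAlpha α) 1 ε = oneCorr α ε := by
  rw [corrIntegral_delahaye hα, oneCorr]
  congr 1
  ext p
  rw [mem_ofPred_eq, mem_ofPred_eq, orbitDist_kappa_le_iff hα hε]
  constructor
  · intro h
    exact h 0 (by simp)
  · intro h i hi
    have : i = 0 := by
      have : i < 1 := by exact_mod_cast hi
      omega
    subst this
    exact h

theorem corrIntegral_top {α ε : ℝ} (hα : α ∈ Ioo (0 : ℝ) (1 / 2)) (hε : 0 ≤ ε) :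
    corrIntegral (delahaye α) (muAlpha α) ⊤ ε = infCorr α ε := by
  have hα' : α ∈ Ioc (0 : ℝ) (1 / 2) := ⟨hα.1, hα.2.le⟩
  have hm : MeasurableSet {z | diffNorm α z ≤ ε} :=
    measurableSet_le (measurable_diffNorm hα') measurable_const
  rw [corrIntegral_delahaye hα, infCorr, measureReal_def, measureReal_def,
    ← pairMeasure_subBorrow hm]
  congr 2
  ext p
  rw [mem_ofPred_eq, mem_ofPred_eq, orbitDist_kappa_le_iff hα hε, mem_ofPred_eq, diffNorm,
    ← forall_abs_kappa_odometer_le_iff hα']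
  simp

theorem detInfty_eq {α ε : ℝ} (hα : α ∈ Ioo (0 : ℝ) (1 / 2)) (hε : 0 ≤ ε) :
    detInfty (delahaye α) (muAlpha α) ε = infCorr α ε / oneCorr α ε := by
  rw [detInfty, corrIntegral_one hα hε, corrIntegral_top hα hε]

/-! ### The laws involved have no atoms -/

theorem coinMeasure_kappa_eq_rec {α : ℝ} (hα : α ∈ Ioc (0 : ℝ) (1 / 2)) (c : ℝ) :
    coinMeasure.real {w | kappa α w = c} = 1 / 2 * coinMeasure.real {w | kappa α w = c / α} +
      1 / 2 * coinMeasure.real {w | kappa α w = (c - 1 + α) / α} := by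
  have hm : MeasurableSet {w | kappa α w = c} :=
    measurableSet_eq_fun (measurable_kappa_of_mem hα) measurable_const
  rw [coinMeasure_real hm]
  congr 3
  · ext w
    simp only [mem_preimage, mem_ofPred_eq, kappa_consBit_false hα]
    rw [eq_div_iff hα.1.ne', mul_comm]
  · ext w
    simp only [mem_preimage, mem_ofPred_eq, kappa_consBit_true hα]
    rw [eq_div_iff hα.1.ne']
    constructor <;> intro h <;> linarith

theorem coinMeasure_kappa_eq_of_notMem {α c : ℝ} (hα : α ∈ Ioc (0 : ℝ) (1 / 2))
    (hc : c ∉ Icc (0 : ℝ) 1) : coinMeasure.real {w | kappa α w = c} = 0 := by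
  have : {w | kappa α w = c} = ∅ := by
    ext w
    simp only [mem_ofPred_eq, mem_empty_iff_false, iff_false]
    rintro rfl
    exact hc ⟨kappa_nonneg hα w, kappa_le_one hα w⟩
  simp [this]

/-- The law of `κ_α` has no atoms: the mass of an endpoint equals half of itself, and
the mass of any other point is at most half the mass of some point. -/
theorem coinMeasure_kappa_eq {α : ℝ} (hα : α ∈ Ioc (0 : ℝ) (1 / 2)) (c : ℝ) :
    coinMeasure.real {w | kappa α w = c} = 0 := by
  obtain ⟨h0, h1⟩ := id hα
  have hzero : coinMeasure.real {w | kappa α w = 0} = 0 := by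
    have h := coinMeasure_kappa_eq_rec hα 0
    rw [coinMeasure_kappa_eq_of_notMem hα (c := (0 - 1 + α) / α)
      (fun hc => by rw [mem_Icc, le_div_iff₀ h0] at hc; linarith [hc.1]), zero_div] at h
    linarith
  have hone : coinMeasure.real {w | kappa α w = 1} = 0 := by
    have h := coinMeasure_kappa_eq_rec hα 1
    rw [coinMeasure_kappa_eq_of_notMem hα (c := 1 / α)
      (fun hc => by rw [mem_Icc, div_le_iff₀ h0] at hc; linarith [hc.2]),
      show (1 - 1 + α) / α = 1 by rw [sub_self, zero_add, div_self h0.ne']] at h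
    linarith
  have key : ∀ n : ℕ, ∀ c, coinMeasure.real {w | kappa α w = c} ≤ (1 / 2 : ℝ) ^ n := by
    intro n
    induction n with
    | zero => exact fun c => by simp
    | succ n ih =>
      intro c
      rw [coinMeasure_kappa_eq_rec hα, pow_succ']
      rcases lt_or_ge c (1 - α) with hc | hc
      · rw [coinMeasure_kappa_eq_of_notMem hα (c := (c - 1 + α) / α)
          (fun hc => by rw [mem_Icc, le_div_iff₀ h0] at hc; linarith [hc.1])]
        linarith [ih (c / α)]
      rcases lt_or_ge α c with hc' | hc'
      · rw [coinMeasure_kappa_eq_of_notMem hα (c := c / α)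
          (fun hc => by rw [mem_Icc, div_le_iff₀ h0] at hc; linarith [hc.2])]
        linarith [ih ((c - 1 + α) / α)]
      -- the two halves of the Cantor set meet only if `α = c = 1/2`
      obtain rfl : α = 1 / 2 := by linarith
      obtain rfl : c = 1 / 2 := by linarith
      norm_num
      rw [hone, hzero]
      norm_num
  have hlim : Tendsto (fun n : ℕ => (1 / 2 : ℝ) ^ n) atTop (𝓝 0) :=
    tendsto_pow_atTop_nhds_zero_of_lt_one (by norm_num) (by norm_num)
  exact le_antisymm (ge_of_tendsto' hlim fun n => key n c) measureReal_nonneg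

theorem diffNorm_consBit_false {α : ℝ} (hα : α ∈ Ioc (0 : ℝ) (1 / 2)) (w : ℕ → Bool) :
    diffNorm α (consBit false w) = α * diffNorm α w := by
  rw [diffNorm, negBits_consBit_false, kappa_consBit_false hα, kappa_consBit_false hα, diffNorm,
    mul_max_of_nonneg _ _ hα.1.le]

theorem diffNorm_consBit_true {α : ℝ} (hα : α ∈ Ioc (0 : ℝ) (1 / 2)) (w : ℕ → Bool) :
    diffNorm α (consBit true w) = max (1 - α + α * kappa α w) (1 - α * kappa α w) := by
  rw [diffNorm, negBits_consBit_true, kappa_consBit_true hα, kappa_consBit_true hα, kappa_not hα]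
  congr 1
  ring

theorem coinMeasure_diffNorm_eq {α ε : ℝ} (hα : α ∈ Ioc (0 : ℝ) (1 / 2)) (hε : 0 < ε) :
    coinMeasure.real {z | diffNorm α z = ε} = 0 := by
  have h0 := hα.1
  have key : ∀ n : ℕ, ∀ ε, 0 < ε → coinMeasure.real {z | diffNorm α z = ε} ≤ (1 / 2 : ℝ) ^ n := by
    intro n
    induction n with
    | zero => exact fun c _ => by simp
    | succ n ih =>
      intro ε hε
      have hm : MeasurableSet {z | diffNorm α z = ε} :=
        measurableSet_eq_fun (measurable_diffNorm hα) measurable_const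
      have e1 : consBit false ⁻¹' {z | diffNorm α z = ε} = {z | diffNorm α z = ε / α} := by
        ext w
        simp only [mem_preimage, mem_ofPred_eq, diffNorm_consBit_false hα]
        rw [eq_div_iff h0.ne', mul_comm]
      have e2 : coinMeasure.real (consBit true ⁻¹' {z | diffNorm α z = ε}) = 0 := by
        have hsub : consBit true ⁻¹' {z | diffNorm α z = ε} ⊆
            {w | kappa α w = (ε - 1 + α) / α} ∪ {w | kappa α w = (1 - ε) / α} := by
          intro w hw
          simp only [mem_preimage, mem_ofPred_eq, diffNorm_consBit_true hα] at hw
          rw [mem_union, mem_ofPred_eq, mem_ofPred_eq, eq_div_iff h0.ne', eq_div_iff h0.ne']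
          rcases max_choice (1 - α + α * kappa α w) (1 - α * kappa α w) with h | h
          · left; linarith
          · right; linarith
        refine le_antisymm ((measureReal_mono hsub).trans ((measureReal_union_le _ _).trans ?_))
          measureReal_nonneg
        rw [coinMeasure_kappa_eq hα, coinMeasure_kappa_eq hα, add_zero]
      rw [coinMeasure_real hm, e1, e2, pow_succ']
      linarith [ih (ε / α) (div_pos hε h0)]
  have hlim : Tendsto (fun n : ℕ => (1 / 2 : ℝ) ^ n) atTop (𝓝 0) :=
    tendsto_pow_atTop_nhds_zero_of_lt_one (by norm_num) (by norm_num)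
  exact le_antisymm (ge_of_tendsto' hlim fun n => key n ε hε) measureReal_nonneg

theorem pairMeasure_kappa_sub_eq {α : ℝ} (hα : α ∈ Ioc (0 : ℝ) (1 / 2)) (c : ℝ) :
    pairMeasure.real {p | kappa α p.1 - kappa α p.2 = c} = 0 := by
  have hm : MeasurableSet {p : (ℕ → Bool) × (ℕ → Bool) | kappa α p.1 - kappa α p.2 = c} :=
    measurableSet_eq_fun (measurable_kappa_sub hα) measurable_const
  rw [measureReal_def, pairMeasure, Measure.prod_apply hm]
  have : ∀ u : ℕ → Bool,
      coinMeasure (Prod.mk u ⁻¹' {p | kappa α p.1 - kappa α p.2 = c}) = 0 := by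
    intro u
    have h := coinMeasure_kappa_eq hα (kappa α u - c)
    rw [measureReal_eq_zero_iff] at h
    rw [← h]
    congr 1
    ext v
    simp only [mem_preimage, mem_ofPred_eq]
    constructor <;> intro h <;> linarith
  simp only [this, lintegral_const, zero_mul, ENNReal.toReal_zero]

theorem pairMeasure_abs_kappa_sub_eq {α : ℝ} (hα : α ∈ Ioc (0 : ℝ) (1 / 2)) (c : ℝ) :
    pairMeasure.real {p | |kappa α p.1 - kappa α p.2| = c} = 0 := by
  have hsub : {p : (ℕ → Bool) × (ℕ → Bool) | |kappa α p.1 - kappa α p.2| = c} ⊆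
      {p | kappa α p.1 - kappa α p.2 = c} ∪ {p | kappa α p.1 - kappa α p.2 = -c} := by
    intro p hp
    rw [mem_ofPred_eq] at hp
    rcases abs_choice (kappa α p.1 - kappa α p.2) with h | h
    · left; rw [mem_ofPred_eq]; linarith
    · right; rw [mem_ofPred_eq]; linarith
  refine le_antisymm ((measureReal_mono hsub).trans ((measureReal_union_le _ _).trans ?_))
    measureReal_nonneg
  rw [pairMeasure_kappa_sub_eq hα, pairMeasure_kappa_sub_eq hα, add_zero]

/-! ### Joint continuity in the parameter and the radius -/

/-- If `h a ω` is continuous in `a` and its law has no atoms in `U`, then its distribution function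
is jointly continuous in `a` and in the argument ranging over `U`. -/
theorem continuousOn_measureReal_le {Ω : Type*} [MeasurableSpace Ω] {P : Measure Ω}
    [IsProbabilityMeasure P] {h : ℝ → Ω → ℝ} {S U : Set ℝ}
    (hc : ∀ ω, ContinuousOn (fun a => h a ω) S) (hm : ∀ a ∈ S, Measurable (h a))
    (hatom : ∀ a ∈ S, ∀ x ∈ U, P.real {ω | h a ω = x} = 0) :
    ContinuousOn (fun p : ℝ × ℝ => P.real {ω | h p.1 ω ≤ p.2}) (S ×ˢ U) := by
  rw [continuousOn_iff_continuous_domRestrict, continuous_iff_continuousAt]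
  rintro ⟨⟨a, x⟩, ha, hx⟩
  refine (ENNReal.tendsto_toReal (measure_ne_top P _)).comp
    (tendsto_measure_of_ae_tendsto_indicator_of_isFiniteMeasure (𝓝 _) ?_ ?_ ?_)
  · exact measurableSet_le (hm a ha) measurable_const
  · exact fun q => measurableSet_le (hm _ q.2.1) measurable_const
  · have h0 := hatom a ha x hx
    rw [measureReal_eq_zero_iff] at h0
    have h1 : ∀ᵐ ω ∂P, h a ω ≠ x := by
      rw [ae_iff]
      simpa using h0
    filter_upwards [h1] with ω hω
    have hcont : Continuous fun q : ↥(S ×ˢ U) => h q.1.1 ω - q.1.2 := by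
      refine Continuous.sub ?_ (by fun_prop)
      exact (hc ω).comp_continuous (by fun_prop) fun q => q.2.1
    have hcont' := hcont.tendsto ⟨(a, x), ha, hx⟩
    rcases lt_or_gt_of_ne hω with hlt | hlt
    · filter_upwards [hcont'.eventually_lt_const (u := 0) (by simpa using hlt)] with q hq
      exact ⟨fun _ => hlt.le, fun _ => show h q.1.1 ω ≤ q.1.2 by linarith⟩
    · filter_upwards [hcont'.eventually_const_lt (u := 0) (by simpa using hlt)] with q hq
      exact ⟨fun (hq' : h q.1.1 ω ≤ q.1.2) => by linarith,
        fun h' => absurd h' (not_le.2 hlt)⟩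

theorem continuousOn_infCorr :
    ContinuousOn (fun p : ℝ × ℝ => infCorr p.1 p.2) (Ioc 0 (1 / 2) ×ˢ Ioi 0) := by
  have hc : ∀ z, ContinuousOn (fun a => diffNorm a z) (Ioc 0 (1 / 2)) := fun z =>
    ((continuousOn_kappa_left z).mono Ioc_subset_Icc_self).sup
      ((continuousOn_kappa_left _).mono Ioc_subset_Icc_self)
  exact continuousOn_measureReal_le (P := coinMeasure) (h := diffNorm) hc
    (fun a ha => measurable_diffNorm ha) fun a ha x hx => coinMeasure_diffNorm_eq ha hx

theorem continuousOn_oneCorr :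
    ContinuousOn (fun p : ℝ × ℝ => oneCorr p.1 p.2) (Ioc 0 (1 / 2) ×ˢ Ioi 0) := by
  have hc : ∀ p : (ℕ → Bool) × (ℕ → Bool),
      ContinuousOn (fun a => |kappa a p.1 - kappa a p.2|) (Ioc 0 (1 / 2)) := fun p =>
    (((continuousOn_kappa_left p.1).mono Ioc_subset_Icc_self).sub
      ((continuousOn_kappa_left p.2).mono Ioc_subset_Icc_self)).abs
  have hm : ∀ a ∈ Ioc (0 : ℝ) (1 / 2), Measurable fun p : (ℕ → Bool) × (ℕ → Bool) =>
      |kappa a p.1 - kappa a p.2| := fun a ha => (measurable_kappa_sub ha).abs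
  exact continuousOn_measureReal_le (P := pairMeasure)
    (h := fun a p => |kappa a p.1 - kappa a p.2|) hc hm
    fun a ha x _ => pairMeasure_abs_kappa_sub_eq ha x

/-! ### Self-similarity of the distribution functions -/

theorem kappaCdf_rec {α : ℝ} (hα : α ∈ Ioc (0 : ℝ) (1 / 2)) (x : ℝ) :
    kappaCdf α x = 1 / 2 * kappaCdf α (x / α) + 1 / 2 * kappaCdf α ((x - 1 + α) / α) := by
  have hm : MeasurableSet {w | kappa α w ≤ x} :=
    measurableSet_le (measurable_kappa_of_mem hα) measurable_const
  rw [kappaCdf, coinMeasure_real hm, kappaCdf, kappaCdf]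
  congr 3
  · ext w
    simp only [mem_preimage, mem_ofPred_eq, kappa_consBit_false hα]
    rw [le_div_iff₀ hα.1, mul_comm]
  · ext w
    simp only [mem_preimage, mem_ofPred_eq, kappa_consBit_true hα]
    rw [le_div_iff₀ hα.1]
    constructor <;> intro h <;> linarith

theorem kappaCdf_nonneg (α x : ℝ) : 0 ≤ kappaCdf α x := measureReal_nonneg

theorem kappaCdf_le_one (α x : ℝ) : kappaCdf α x ≤ 1 := measureReal_le_one

theorem kappaCdf_of_nonpos {α x : ℝ} (hα : α ∈ Ioc (0 : ℝ) (1 / 2)) (hx : x ≤ 0) :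
    kappaCdf α x = 0 := by
  refine le_antisymm ?_ measureReal_nonneg
  rw [← coinMeasure_kappa_eq hα 0]
  exact measureReal_mono fun w (hw : kappa α w ≤ x) =>
    le_antisymm (hw.trans hx) (kappa_nonneg hα w)

theorem kappaCdf_of_one_le {α x : ℝ} (hα : α ∈ Ioc (0 : ℝ) (1 / 2)) (hx : 1 ≤ x) :
    kappaCdf α x = 1 := by
  have : {w | kappa α w ≤ x} = univ := eq_univ_of_forall fun w => (kappa_le_one hα w).trans hx
  rw [kappaCdf, this, probReal_univ]

/-- The coin-tossing measure is invariant under complementation of all the bits. -/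
theorem map_not : coinMeasure.map (fun w n => !w n) = coinMeasure := by
  have hm : Measurable fun (w : ℕ → Bool) n => !w n :=
    measurable_pi_lambda _ fun n =>
      (Measurable.of_discrete (f := Bool.not)).comp (measurable_pi_apply n)
  refine eq_coinMeasure fun k w => ?_
  rw [Measure.map_apply hm (measurableSet_prefix k w), ← coinMeasure_prefix k fun n => !w n]
  congr 1
  ext v
  simp only [mem_preimage, mem_ofPred_eq]
  refine forall₂_congr fun i _ => ?_
  cases v i <;> cases w i <;> simp

theorem coinMeasure_one_sub_kappa {α : ℝ} (hα : α ∈ Ioc (0 : ℝ) (1 / 2)) (x : ℝ) :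
    coinMeasure.real {w | 1 - kappa α w ≤ x} = kappaCdf α x := by
  have hm : Measurable fun (w : ℕ → Bool) n => !w n :=
    measurable_pi_lambda _ fun n =>
      (Measurable.of_discrete (f := Bool.not)).comp (measurable_pi_apply n)
  have hm' : MeasurableSet {w | kappa α w ≤ x} :=
    measurableSet_le (measurable_kappa_of_mem hα) measurable_const
  rw [kappaCdf]
  conv_rhs => rw [← map_not]
  rw [measureReal_def, measureReal_def, Measure.map_apply hm hm']
  congr 2
  ext w
  rw [mem_ofPred_eq, mem_preimage, mem_ofPred_eq, kappa_not hα]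

theorem infCorr_nonneg (α ε : ℝ) : 0 ≤ infCorr α ε := measureReal_nonneg

theorem infCorr_of_one_le {α ε : ℝ} (hα : α ∈ Ioc (0 : ℝ) (1 / 2)) (hε : 1 ≤ ε) :
    infCorr α ε = 1 := by
  have : {z | diffNorm α z ≤ ε} = univ := eq_univ_of_forall fun z => (diffNorm_le_one hα z).trans hε
  rw [infCorr, this, probReal_univ]

/-- If `z` is even then `diffNorm z = α * diffNorm (z / 2)`; if `z` is odd then `diffNorm z` is
`1 - α² t` with `t` distributed as `κ`, up to the symmetry of that law. -/
theorem infCorr_rec {α : ℝ} (hα : α ∈ Ioc (0 : ℝ) (1 / 2)) (ε : ℝ) :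
    infCorr α ε =
      1 / 2 * infCorr α (ε / α) + 1 / 2 * kappaCdf α ((ε - 1 + α ^ 2) / α ^ 2) := by
  obtain ⟨h0, h1⟩ := id hα
  have hsq : 0 < α ^ 2 := pow_pos h0 2
  have hm : MeasurableSet {z | diffNorm α z ≤ ε} :=
    measurableSet_le (measurable_diffNorm hα) measurable_const
  rw [infCorr, coinMeasure_real hm]
  congr 2
  · rw [infCorr]
    congr 1
    ext w
    simp only [mem_preimage, mem_ofPred_eq, diffNorm_consBit_false hα]
    rw [le_div_iff₀ h0, mul_comm]
  · have hm' := measurable_consBit true hm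
    have e1 : consBit false ⁻¹' (consBit true ⁻¹' {z | diffNorm α z ≤ ε}) =
        {w | 1 - kappa α w ≤ (ε - 1 + α ^ 2) / α ^ 2} := by
      ext w
      have := kappa_nonneg hα w
      have := kappa_le_one hα w
      simp only [mem_preimage, mem_ofPred_eq, diffNorm_consBit_true hα, kappa_consBit_false hα]
      rw [le_div_iff₀ hsq, max_le_iff]
      constructor
      · intro h; nlinarith [h.2]
      · intro h; constructor <;> nlinarith
    have e2 : consBit true ⁻¹' (consBit true ⁻¹' {z | diffNorm α z ≤ ε}) =
        {w | kappa α w ≤ (ε - 1 + α ^ 2) / α ^ 2} := by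
      ext w
      have := kappa_nonneg hα w
      have := kappa_le_one hα w
      simp only [mem_preimage, mem_ofPred_eq, diffNorm_consBit_true hα, kappa_consBit_true hα]
      rw [le_div_iff₀ hsq, max_le_iff]
      constructor
      · intro h; nlinarith [h.1]
      · intro h; constructor <;> nlinarith
    rw [coinMeasure_real hm', e1, e2, coinMeasure_one_sub_kappa hα, kappaCdf]
    ring

/-- For `ε ≤ 1` odd differences are never `α ε`-small, so only the even ones contribute. -/
theorem infCorr_mul {α ε : ℝ} (hα : α ∈ Ioc (0 : ℝ) (1 / 2)) (hε : ε ≤ 1) :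
    infCorr α (α * ε) = 1 / 2 * infCorr α ε := by
  obtain ⟨h0, h1⟩ := id hα
  rw [infCorr_rec hα, mul_div_cancel_left₀ _ h0.ne', kappaCdf_of_nonpos hα, mul_zero, add_zero]
  exact div_nonpos_of_nonpos_of_nonneg (by nlinarith) (by positivity)

theorem oneCorr_nonneg (α ε : ℝ) : 0 ≤ oneCorr α ε := measureReal_nonneg

theorem oneCorr_le_one (α ε : ℝ) : oneCorr α ε ≤ 1 := measureReal_le_one

theorem oneCorr_mono (α : ℝ) {x y : ℝ} (h : x ≤ y) : oneCorr α x ≤ oneCorr α y :=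
  measureReal_mono fun _ (hp : _ ≤ x) => hp.trans h

theorem oneCorr_of_one_le {α ε : ℝ} (hα : α ∈ Ioc (0 : ℝ) (1 / 2)) (hε : 1 ≤ ε) :
    oneCorr α ε = 1 := by
  have : {p : (ℕ → Bool) × (ℕ → Bool) | |kappa α p.1 - kappa α p.2| ≤ ε} = univ :=
    eq_univ_of_forall fun p => (abs_kappa_sub_le_one hα _ _).trans hε
  rw [oneCorr, this, probReal_univ]

theorem oneCorr_zero {α : ℝ} (hα : α ∈ Ioc (0 : ℝ) (1 / 2)) : oneCorr α 0 = 0 := by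
  refine le_antisymm ?_ measureReal_nonneg
  refine le_of_le_of_eq ?_ (pairMeasure_abs_kappa_sub_eq hα 0)
  exact measureReal_mono fun p (hp : |kappa α p.1 - kappa α p.2| ≤ 0) =>
    le_antisymm hp (abs_nonneg _)

theorem pairMeasure_swap {A : Set ((ℕ → Bool) × (ℕ → Bool))} (hA : MeasurableSet A) :
    pairMeasure.real (Prod.swap ⁻¹' A) = pairMeasure.real A := by
  conv_rhs => rw [pairMeasure, ← Measure.prod_swap]
  rw [measureReal_def, measureReal_def, Measure.map_apply measurable_swap hA]

/-- The probability that independent points `x, y` of law `μ_α` satisfy `x - y > t`. -/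
noncomputable def upperTail (α t : ℝ) : ℝ :=
  pairMeasure.real {p | t < kappa α p.1 - kappa α p.2}

theorem measurableSet_upperTail {α : ℝ} (hα : α ∈ Ioc (0 : ℝ) (1 / 2)) (t : ℝ) :
    MeasurableSet {p : (ℕ → Bool) × (ℕ → Bool) | t < kappa α p.1 - kappa α p.2} :=
  measurableSet_lt measurable_const (measurable_kappa_sub hα)

theorem upperTail_anti (α : ℝ) {s t : ℝ} (h : s ≤ t) : upperTail α t ≤ upperTail α s :=
  measureReal_mono fun _ (hp : t < _) => h.trans_lt hp

theorem pairMeasure_le {α : ℝ} (hα : α ∈ Ioc (0 : ℝ) (1 / 2)) (t : ℝ) :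
    pairMeasure.real {p | kappa α p.1 - kappa α p.2 ≤ t} = 1 - upperTail α t := by
  rw [upperTail, ← probReal_compl_eq_one_sub (measurableSet_upperTail hα t)]
  congr 1
  ext p
  simp

theorem pairMeasure_lt_neg {α : ℝ} (hα : α ∈ Ioc (0 : ℝ) (1 / 2)) (t : ℝ) :
    pairMeasure.real {p | kappa α p.1 - kappa α p.2 < -t} = upperTail α t := by
  rw [upperTail, ← pairMeasure_swap (measurableSet_upperTail hα t)]
  congr 1
  ext p
  simp only [mem_preimage, mem_ofPred_eq, Prod.fst_swap, Prod.snd_swap]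
  constructor <;> intro h <;> linarith

theorem upperTail_neg {α : ℝ} (hα : α ∈ Ioc (0 : ℝ) (1 / 2)) (t : ℝ) :
    upperTail α (-t) = 1 - upperTail α t := by
  have h1 := pairMeasure_le hα (-t)
  have h2 := pairMeasure_lt_neg hα t
  have h3 : pairMeasure.real {p | kappa α p.1 - kappa α p.2 ≤ -t} ≤
      pairMeasure.real {p | kappa α p.1 - kappa α p.2 < -t} + 0 := by
    rw [← pairMeasure_kappa_sub_eq hα (-t)]
    refine (measureReal_mono ?_).trans (measureReal_union_le _ _)
    intro p (hp : kappa α p.1 - kappa α p.2 ≤ -t)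
    exact hp.lt_or_eq
  have h4 : pairMeasure.real {p | kappa α p.1 - kappa α p.2 < -t} ≤
      pairMeasure.real {p | kappa α p.1 - kappa α p.2 ≤ -t} :=
    measureReal_mono fun p (hp : _ < -t) => hp.le
  linarith

theorem upperTail_eq {α t : ℝ} (hα : α ∈ Ioc (0 : ℝ) (1 / 2)) (ht : 0 ≤ t) :
    upperTail α t = 1 / 2 * (1 - oneCorr α t) := by
  have hm : MeasurableSet {p : (ℕ → Bool) × (ℕ → Bool) | |kappa α p.1 - kappa α p.2| ≤ t} :=
    measurableSet_le (measurable_kappa_sub hα).abs measurable_const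
  have h : pairMeasure.real {p | |kappa α p.1 - kappa α p.2| ≤ t}ᶜ =
      pairMeasure.real {p | kappa α p.1 - kappa α p.2 < -t} + upperTail α t := by
    rw [upperTail, ← measureReal_union _ (measurableSet_upperTail hα t)]
    · congr 1
      ext p
      simp only [mem_compl_iff, mem_ofPred_eq, not_le, mem_union, lt_abs]
      constructor
      · rintro (h | h)
        · exact Or.inr h
        · left; linarith
      · rintro (h | h)
        · right; linarith
        · exact Or.inl h
    · rw [Set.disjoint_left]
      intro p (h1 : _ < -t) (h2 : t < _)
      linarith
  rw [probReal_compl_eq_one_sub hm, pairMeasure_lt_neg hα] at h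
  rw [oneCorr]
  linarith

/-- The probability that two points with different first digits are `ε`-close. -/
noncomputable def crossCorr (α ε : ℝ) : ℝ :=
  pairMeasure.real {p | |1 - α + α * (kappa α p.1 - kappa α p.2)| ≤ ε}

theorem crossCorr_nonneg (α ε : ℝ) : 0 ≤ crossCorr α ε := measureReal_nonneg

/-- Points with equal first digits are scaled copies of a pair at distance `ε / α`. -/
theorem oneCorr_rec {α : ℝ} (hα : α ∈ Ioc (0 : ℝ) (1 / 2)) (ε : ℝ) :
    oneCorr α ε = 1 / 2 * oneCorr α (ε / α) + 1 / 2 * crossCorr α ε := by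
  obtain ⟨h0, h1⟩ := id hα
  have hm : MeasurableSet {p : (ℕ → Bool) × (ℕ → Bool) | |kappa α p.1 - kappa α p.2| ≤ ε} :=
    measurableSet_le (measurable_kappa_sub hα).abs measurable_const
  have hm' : MeasurableSet {p : (ℕ → Bool) × (ℕ → Bool) |
      |1 - α + α * (kappa α p.1 - kappa α p.2)| ≤ ε} :=
    measurableSet_le (((measurable_kappa_sub hα).const_mul α).const_add (1 - α)).abs
      measurable_const
  have e0 : ∀ b, Prod.map (consBit b) (consBit b) ⁻¹'
      {p : (ℕ → Bool) × (ℕ → Bool) | |kappa α p.1 - kappa α p.2| ≤ ε} =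
      {p | |kappa α p.1 - kappa α p.2| ≤ ε / α} := by
    intro b
    ext p
    simp only [mem_preimage, mem_ofPred_eq, Prod.map_fst, Prod.map_snd, kappa_consBit hα]
    rw [le_div_iff₀ h0, add_sub_add_left_eq_sub, ← mul_sub, abs_mul, abs_of_pos h0, mul_comm]
  have e1 : Prod.map (consBit true) (consBit false) ⁻¹'
      {p : (ℕ → Bool) × (ℕ → Bool) | |kappa α p.1 - kappa α p.2| ≤ ε} =
      {p | |1 - α + α * (kappa α p.1 - kappa α p.2)| ≤ ε} := by
    ext p
    simp only [mem_preimage, mem_ofPred_eq, Prod.map_fst, Prod.map_snd, kappa_consBit_true hα,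
      kappa_consBit_false hα]
    rw [show 1 - α + α * kappa α p.1 - α * kappa α p.2 =
      1 - α + α * (kappa α p.1 - kappa α p.2) by ring]
  have e2 : Prod.map (consBit false) (consBit true) ⁻¹'
      {p : (ℕ → Bool) × (ℕ → Bool) | |kappa α p.1 - kappa α p.2| ≤ ε} =
      Prod.swap ⁻¹' {p | |1 - α + α * (kappa α p.1 - kappa α p.2)| ≤ ε} := by
    ext p
    simp only [mem_preimage, mem_ofPred_eq, Prod.map_fst, Prod.map_snd, kappa_consBit_true hα,
      kappa_consBit_false hα, Prod.fst_swap, Prod.snd_swap]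
    rw [abs_sub_comm, show 1 - α + α * kappa α p.2 - α * kappa α p.1 =
      1 - α + α * (kappa α p.2 - kappa α p.1) by ring]
  rw [oneCorr, pairMeasure_real hm, e0, e0, e1, e2, pairMeasure_swap hm', oneCorr, crossCorr]
  ring

theorem le_oneCorr_mul {α : ℝ} (hα : α ∈ Ioc (0 : ℝ) (1 / 2)) (ε : ℝ) :
    1 / 2 * oneCorr α ε ≤ oneCorr α (α * ε) := by
  rw [oneCorr_rec hα (α * ε), mul_div_cancel_left₀ _ hα.1.ne']
  linarith [crossCorr_nonneg α (α * ε)]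

/-- Below the gap `1 - 2 α` between the two halves of the Cantor set, close points have the same
first digit. -/
theorem crossCorr_eq_zero {α ε : ℝ} (hα : α ∈ Ioc (0 : ℝ) (1 / 2)) (hε : ε < 1 - 2 * α) :
    crossCorr α ε = 0 := by
  have : {p : (ℕ → Bool) × (ℕ → Bool) | |1 - α + α * (kappa α p.1 - kappa α p.2)| ≤ ε} = ∅ := by
    ext p
    simp only [mem_ofPred_eq, mem_empty_iff_false, iff_false, not_le]
    have h := (abs_le.1 (abs_kappa_sub_le_one hα p.1 p.2)).1
    refine lt_of_lt_of_le ?_ (le_abs_self _)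
    nlinarith [hα.1]
  rw [crossCorr, this, measureReal_empty]

theorem oneCorr_mul {α ε : ℝ} (hα : α ∈ Ioc (0 : ℝ) (1 / 2)) (hε : α * ε < 1 - 2 * α) :
    oneCorr α (α * ε) = 1 / 2 * oneCorr α ε := by
  rw [oneCorr_rec hα (α * ε), mul_div_cancel_left₀ _ hα.1.ne', crossCorr_eq_zero hα hε]
  ring

theorem oneCorr_pos {α ε : ℝ} (hα : α ∈ Ioc (0 : ℝ) (1 / 2)) (hε : 0 < ε) : 0 < oneCorr α ε := by
  have h : ∀ n : ℕ, (1 / 2 : ℝ) ^ n ≤ oneCorr α (α ^ n) := by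
    intro n
    induction n with
    | zero => simp [oneCorr_of_one_le hα]
    | succ n ih =>
      rw [pow_succ', pow_succ']
      linarith [le_oneCorr_mul hα (α ^ n)]
  obtain ⟨n, hn⟩ := exists_pow_lt_of_lt_one hε (by linarith [hα.2] : α < 1)
  exact lt_of_lt_of_le (by positivity) ((h n).trans (oneCorr_mono α hn.le))

theorem crossCorr_eq {α ε : ℝ} (hα : α ∈ Ioc (0 : ℝ) (1 / 2)) (hε : 2 * α - 1 ≤ ε) :
    crossCorr α ε = 1 - upperTail α ((ε - 1 + α) / α) := by
  have h0 := hα.1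
  rw [crossCorr, ← pairMeasure_le hα]
  congr 1
  ext p
  have h := (abs_le.1 (abs_kappa_sub_le_one hα p.1 p.2)).1
  rw [mem_ofPred_eq, mem_ofPred_eq, le_div_iff₀ h0, abs_le]
  constructor
  · intro h; linarith [h.2]
  · intro h; constructor <;> nlinarith [hα.2]

/-! ### The limiting parameter `1/2` -/

theorem le_of_forall_le_add_pow {a b r : ℝ} (hr : 0 ≤ r) (hr1 : r < 1)
    (h : ∀ n : ℕ, a ≤ b + r ^ n) : a ≤ b := by
  have hlim : Tendsto (fun n : ℕ => b + r ^ n) atTop (𝓝 (b + 0)) :=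
    (tendsto_pow_atTop_nhds_zero_of_lt_one hr hr1).const_add b
  rw [add_zero] at hlim
  exact ge_of_tendsto' hlim h

theorem half_mem : (1 / 2 : ℝ) ∈ Ioc (0 : ℝ) (1 / 2) := by constructor <;> norm_num

theorem oneCorr_half_rec_of_le {x : ℝ} (h0 : 0 ≤ x) (h1 : x ≤ 1 / 2) :
    oneCorr (1 / 2) x = 1 / 2 * oneCorr (1 / 2) (2 * x) +
      1 / 4 * (1 - oneCorr (1 / 2) (1 - 2 * x)) := by
  rw [oneCorr_rec half_mem, crossCorr_eq half_mem (by linarith),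
    show (x - 1 + 1 / 2) / (1 / 2) = -(1 - 2 * x) by ring, upperTail_neg half_mem,
    upperTail_eq half_mem (by linarith), show x / (1 / 2) = 2 * x by ring]
  ring

theorem oneCorr_half_rec_of_ge {x : ℝ} (h1 : 1 / 2 ≤ x) :
    oneCorr (1 / 2) x = 3 / 4 + 1 / 4 * oneCorr (1 / 2) (2 * x - 1) := by
  rw [oneCorr_rec half_mem, crossCorr_eq half_mem (by linarith),
    show (x - 1 + 1 / 2) / (1 / 2) = 2 * x - 1 by ring,
    upperTail_eq half_mem (by linarith), show x / (1 / 2) = 2 * x by ring,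
    oneCorr_of_one_le half_mem (by linarith)]
  ring

/-- At `α = 1/2` two independent points are uniformly distributed on `[0, 1]`. The formula is the
unique bounded solution of the self-similarity equations, which are contracting. -/
theorem oneCorr_half {x : ℝ} (hx : x ∈ Icc (0 : ℝ) 1) : oneCorr (1 / 2) x = 2 * x - x ^ 2 := by
  have key : ∀ n : ℕ, ∀ x ∈ Icc (0 : ℝ) 1,
      |oneCorr (1 / 2) x - (2 * x - x ^ 2)| ≤ (3 / 4 : ℝ) ^ n := by
    intro n
    induction n with
    | zero =>
      rintro x ⟨h0, h1⟩
      have := oneCorr_nonneg (1 / 2) x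
      have := oneCorr_le_one (1 / 2) x
      rw [pow_zero, abs_le]
      constructor <;> nlinarith
    | succ n ih =>
      rintro x ⟨h0, h1⟩
      rw [pow_succ' (3 / 4 : ℝ)]
      have hp : (0 : ℝ) ≤ (3 / 4) ^ n := by positivity
      rcases le_total x (1 / 2) with hx | hx
      · have i1 := abs_le.1 (ih (2 * x) ⟨by linarith, by linarith⟩)
        have i2 := abs_le.1 (ih (1 - 2 * x) ⟨by linarith, by linarith⟩)
        rw [oneCorr_half_rec_of_le h0 hx, abs_le]
        constructor <;> nlinarith [i1.1, i1.2, i2.1, i2.2]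
      · have i1 := abs_le.1 (ih (2 * x - 1) ⟨by linarith, by linarith⟩)
        rw [oneCorr_half_rec_of_ge hx, abs_le]
        constructor <;> nlinarith [i1.1, i1.2]
  have h : |oneCorr (1 / 2) x - (2 * x - x ^ 2)| ≤ 0 :=
    le_of_forall_le_add_pow (by norm_num) (by norm_num : (3 / 4 : ℝ) < 1) fun n => by
      simpa using key n x hx
  linarith [abs_nonpos_iff.1 h]

/-- A crude version of the fact that `κ` is uniformly distributed on `[0, 1]` when `α = 1/2`. -/
theorem kappaCdf_half_le {x : ℝ} (hx : x ∈ Icc (-1 : ℝ) 1) :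
    kappaCdf (1 / 2) x ≤ (x + 1) / 2 := by
  have key : ∀ n : ℕ, ∀ x ∈ Icc (-1 : ℝ) 1, kappaCdf (1 / 2) x ≤ (x + 1) / 2 + (1 / 2 : ℝ) ^ n := by
    intro n
    induction n with
    | zero =>
      rintro x ⟨h0, h1⟩
      have := kappaCdf_le_one (1 / 2) x
      rw [pow_zero]; linarith
    | succ n ih =>
      rintro x ⟨h0, h1⟩
      have hp : (0 : ℝ) < (1 / 2) ^ n := by positivity
      rw [pow_succ']
      rcases le_total x 0 with hx | hx
      · rw [kappaCdf_of_nonpos half_mem hx]; linarith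
      rw [kappaCdf_rec half_mem, show x / (1 / 2) = 2 * x by ring,
        show (x - 1 + 1 / 2) / (1 / 2) = 2 * x - 1 by ring]
      have := kappaCdf_le_one (1 / 2) (2 * x)
      rcases le_total x (1 / 2) with hx' | hx'
      · rw [kappaCdf_of_nonpos half_mem (by linarith : 2 * x - 1 ≤ 0)]; linarith
      · linarith [ih (2 * x - 1) ⟨by linarith, by linarith⟩]
  exact le_of_forall_le_add_pow (by norm_num) (by norm_num : (1 / 2 : ℝ) < 1) fun n => key n x hx

theorem infCorr_half_le {x : ℝ} (hx : x ∈ Icc (0 : ℝ) 1) : infCorr (1 / 2) x ≤ x := by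
  have key : ∀ n : ℕ, ∀ x ∈ Icc (0 : ℝ) 1, infCorr (1 / 2) x ≤ x + (1 / 2 : ℝ) ^ n := by
    intro n
    induction n with
    | zero =>
      rintro x ⟨h0, h1⟩
      have : infCorr (1 / 2) x ≤ 1 := measureReal_le_one
      rw [pow_zero]; linarith
    | succ n ih =>
      rintro x ⟨h0, h1⟩
      have hp : (0 : ℝ) < (1 / 2) ^ n := by positivity
      rw [pow_succ', infCorr_rec half_mem, show x / (1 / 2) = 2 * x by ring,
        show (x - 1 + (1 / 2) ^ 2) / (1 / 2) ^ 2 = 4 * x - 3 by ring]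
      rcases le_total x (1 / 2) with hx' | hx'
      · rw [kappaCdf_of_nonpos half_mem (by linarith : 4 * x - 3 ≤ 0)]
        linarith [ih (2 * x) ⟨by linarith, by linarith⟩]
      · rw [infCorr_of_one_le half_mem (by linarith)]
        linarith [kappaCdf_half_le (x := 4 * x - 3) ⟨by linarith, by linarith⟩]
  exact le_of_forall_le_add_pow (by norm_num) (by norm_num : (1 / 2 : ℝ) < 1) fun n => key n x hx

/-- At the radii `3/4 * 2⁻ᵏ` the odd differences contribute nothing to `c_∞` at their scale. -/
theorem infCorr_half_eq (k : ℕ) :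
    infCorr (1 / 2) (3 / 4 * (1 / 2) ^ k) = 1 / 2 * (1 / 2 : ℝ) ^ k := by
  induction k with
  | zero =>
    rw [infCorr_rec half_mem, infCorr_of_one_le half_mem (by norm_num),
      kappaCdf_of_nonpos half_mem (by norm_num)]
    norm_num
  | succ k ih =>
    have h1 : (1 / 2 : ℝ) ^ k ≤ 1 := pow_le_one₀ (by norm_num) (by norm_num)
    rw [show 3 / 4 * (1 / 2 : ℝ) ^ (k + 1) = 1 / 2 * (3 / 4 * (1 / 2) ^ k) by ring,
      infCorr_mul half_mem (by linarith), ih]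
    ring

/-! ### The parameter `1/4` -/

theorem quarter_mem : (1 / 4 : ℝ) ∈ Ioc (0 : ℝ) (1 / 2) := by constructor <;> norm_num

theorem oneCorr_quarter_le (x : ℝ) :
    oneCorr (1 / 4) x ≤ 2 * kappaCdf (1 / 4) x := by
  have key : ∀ n : ℕ, ∀ x : ℝ, oneCorr (1 / 4) x ≤ 2 * kappaCdf (1 / 4) x + (1 / 2 : ℝ) ^ n := by
    intro n
    induction n with
    | zero =>
      intro x
      have := oneCorr_le_one (1 / 4) x
      have := kappaCdf_nonneg (1 / 4) x
      rw [pow_zero]; linarith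
    | succ n ih =>
      intro x
      have hp : (0 : ℝ) < (1 / 2) ^ n := by positivity
      have := kappaCdf_nonneg (1 / 4) ((x - 1 + 1 / 4) / (1 / 4))
      rw [pow_succ', kappaCdf_rec quarter_mem]
      rcases le_total (1 / 4) x with hx | hx
      · rw [kappaCdf_of_one_le quarter_mem (by linarith : 1 ≤ x / (1 / 4))]
        linarith [oneCorr_le_one (1 / 4) x]
      · rw [oneCorr_rec quarter_mem, crossCorr_eq_zero quarter_mem (by linarith)]
        linarith [ih (x / (1 / 4))]
  exact le_of_forall_le_add_pow (by norm_num) (by norm_num : (1 / 2 : ℝ) < 1) fun n => key n x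

/-- The contribution of the pairs whose first digits are `1` and `0`. -/
theorem upperTail_rec_le {α : ℝ} (hα : α ∈ Ioc (0 : ℝ) (1 / 2)) (r : ℝ) :
    1 / 4 * upperTail α r ≤ upperTail α (1 - α + α * r) := by
  conv_rhs => rw [upperTail, pairMeasure_real (measurableSet_upperTail hα _)]
  have e : Prod.map (consBit true) (consBit false) ⁻¹'
      {p : (ℕ → Bool) × (ℕ → Bool) | 1 - α + α * r < kappa α p.1 - kappa α p.2} =
      {p | r < kappa α p.1 - kappa α p.2} := by
    ext p
    simp only [mem_preimage, mem_ofPred_eq, Prod.map_fst, Prod.map_snd, kappa_consBit_true hα,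
      kappa_consBit_false hα]
    rw [show 1 - α + α * kappa α p.1 - α * kappa α p.2 =
      1 - α + α * (kappa α p.1 - kappa α p.2) by ring, add_lt_add_iff_left,
      mul_lt_mul_iff_right₀ hα.1]
  rw [e, upperTail]
  have h : ∀ A, 0 ≤ pairMeasure.real A := fun A => measureReal_nonneg
  linarith [h (Prod.map (consBit false) (consBit false) ⁻¹'
      {p : (ℕ → Bool) × (ℕ → Bool) | 1 - α + α * r < kappa α p.1 - kappa α p.2}),
    h (Prod.map (consBit false) (consBit true) ⁻¹'
      {p : (ℕ → Bool) × (ℕ → Bool) | 1 - α + α * r < kappa α p.1 - kappa α p.2}),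
    h (Prod.map (consBit true) (consBit true) ⁻¹'
      {p : (ℕ → Bool) × (ℕ → Bool) | 1 - α + α * r < kappa α p.1 - kappa α p.2})]

/-- On a fundamental domain for the scaling the bound follows from comparing the mass that is
missing from `oneCorr` near the largest possible distance with the mass of `infCorr` there. -/
theorem le_infCorr_quarter_of_ge {e : ℝ} (h0 : 1 / 4 ≤ e) :
    8 / 15 * oneCorr (1 / 4) e ≤ infCorr (1 / 4) e := by
  have hinf := infCorr_rec quarter_mem e
  have hone := oneCorr_rec quarter_mem e
  rw [infCorr_of_one_le quarter_mem (by linarith : 1 ≤ e / (1 / 4))] at hinf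
  rw [oneCorr_of_one_le quarter_mem (by linarith : 1 ≤ e / (1 / 4)),
    crossCorr_eq quarter_mem (by linarith)] at hone
  have ht := upperTail_rec_le quarter_mem ((e - 1 + (1 / 4) ^ 2) / (1 / 4) ^ 2)
  rw [show 1 - 1 / 4 + 1 / 4 * ((e - 1 + (1 / 4 : ℝ) ^ 2) / (1 / 4) ^ 2) =
    (e - 1 + 1 / 4) / (1 / 4) by ring] at ht
  revert hinf ht
  generalize (e - 1 + (1 / 4 : ℝ) ^ 2) / (1 / 4) ^ 2 = r
  intro hinf ht
  have hc := kappaCdf_nonneg (1 / 4) r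
  rcases le_total 0 r with hr | hr
  · rw [upperTail_eq quarter_mem hr] at ht
    linarith [oneCorr_quarter_le r]
  · have h2 := upperTail_anti (1 / 4) hr
    rw [upperTail_eq quarter_mem le_rfl, oneCorr_zero quarter_mem] at h2
    linarith

theorem le_infCorr_quarter (e : ℝ) :
    8 / 15 * oneCorr (1 / 4) e ≤ infCorr (1 / 4) e := by
  have key : ∀ n : ℕ, ∀ e : ℝ,
      8 / 15 * oneCorr (1 / 4) e ≤ infCorr (1 / 4) e + (1 / 2 : ℝ) ^ n := by
    intro n
    induction n with
    | zero =>
      intro e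
      rw [pow_zero]
      linarith [oneCorr_le_one (1 / 4) e, infCorr_nonneg (1 / 4) e]
    | succ n ih =>
      intro e
      have hp : (0 : ℝ) < (1 / 2) ^ n := by positivity
      rw [pow_succ']
      rcases le_total (1 / 4) e with hx | hx
      · linarith [le_infCorr_quarter_of_ge hx]
      · rw [oneCorr_rec quarter_mem, crossCorr_eq_zero quarter_mem (by linarith),
          infCorr_rec quarter_mem]
        linarith [ih (e / (1 / 4)),
          kappaCdf_nonneg (1 / 4) ((e - 1 + (1 / 4) ^ 2) / (1 / 4) ^ 2)]
  exact le_of_forall_le_add_pow (by norm_num) (by norm_num : (1 / 2 : ℝ) < 1) fun n => key n e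

/-! ### The determinism as a function of the parameter and the radius -/

/-- The determinism `c_∞(α, ε) / c_1(α, ε)`, extended to `α = 1/2`. -/
noncomputable def detRatio (α ε : ℝ) : ℝ := infCorr α ε / oneCorr α ε

theorem continuousOn_detRatio :
    ContinuousOn (fun p : ℝ × ℝ => detRatio p.1 p.2) (Ioc 0 (1 / 2) ×ˢ Ioi 0) :=
  continuousOn_infCorr.div continuousOn_oneCorr fun _ hp => (oneCorr_pos hp.1 hp.2).ne'

/-- The determinism decreases under multiplication of the radius by `α`, because `c_∞` is halved
while `c_1` also gains the pairs of close points lying in different halves of the Cantor set. -/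
theorem detRatio_mul_le {α ε : ℝ} (hα : α ∈ Ioc (0 : ℝ) (1 / 2)) (hε : ε ∈ Ioc (0 : ℝ) 1) :
    detRatio α (α * ε) ≤ detRatio α ε := by
  have h := oneCorr_pos hα hε.1
  rw [detRatio, detRatio, infCorr_mul hα hε.2, ← mul_div_mul_left (infCorr α ε) _
    (by norm_num : (1 / 2 : ℝ) ≠ 0)]
  exact div_le_div_of_nonneg_left (by linarith [infCorr_nonneg α ε]) (by linarith)
    (le_oneCorr_mul hα ε)

/-- Once the radius is below the gap, the determinism is multiplicatively periodic. -/
theorem detRatio_mul {α ε : ℝ} (hα : α ∈ Ioc (0 : ℝ) (1 / 2)) (hε : ε ≤ 1)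
    (hε' : α * ε < 1 - 2 * α) : detRatio α (α * ε) = detRatio α ε := by
  rw [detRatio, detRatio, infCorr_mul hα hε, oneCorr_mul hα hε',
    mul_div_mul_left _ _ (by norm_num : (1 / 2 : ℝ) ≠ 0)]

theorem detRatio_pow_mul_le {α ε : ℝ} (hα : α ∈ Ioc (0 : ℝ) (1 / 2)) (hε : ε ∈ Ioc (0 : ℝ) 1)
    (n : ℕ) : detRatio α (α ^ n * ε) ≤ detRatio α ε := by
  induction n with
  | zero => simp
  | succ n ih =>
    rw [pow_succ', mul_assoc]
    have hp : α ^ n ≤ 1 := pow_le_one₀ hα.1.le (by linarith [hα.2])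
    have hp' : 0 < α ^ n := pow_pos hα.1 n
    exact (detRatio_mul_le hα ⟨mul_pos hp' hε.1, by nlinarith [hε.1, hε.2]⟩).trans ih

theorem detRatio_half_le {ε : ℝ} (hε : ε ∈ Ioc (0 : ℝ) 1) :
    detRatio (1 / 2) ε ≤ 1 / (2 - ε) := by
  have h0 := hε.1
  have h1 := hε.2
  rw [detRatio, oneCorr_half ⟨h0.le, h1⟩, div_le_div_iff₀ (by nlinarith) (by linarith)]
  nlinarith [infCorr_half_le (x := ε) ⟨h0.le, h1⟩]

theorem detRatio_half_eq (k : ℕ) :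
    detRatio (1 / 2) (3 / 4 * (1 / 2) ^ k) = 2 / 3 / (2 - 3 / 4 * (1 / 2) ^ k) := by
  have h0 : (0 : ℝ) < (1 / 2) ^ k := by positivity
  have h1 : (1 / 2 : ℝ) ^ k ≤ 1 := pow_le_one₀ (by norm_num) (by norm_num)
  rw [detRatio, infCorr_half_eq, oneCorr_half ⟨by linarith, by linarith⟩,
    div_eq_div_iff (by nlinarith) (by linarith)]
  ring

theorem detRatio_quarter_pow (n : ℕ) : detRatio (1 / 4) ((1 / 4) ^ n) = 1 := by
  induction n with
  | zero =>
    rw [pow_zero, detRatio, infCorr_of_one_le quarter_mem le_rfl,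
      oneCorr_of_one_le quarter_mem le_rfl, div_one]
  | succ n ih =>
    have h1 : (1 / 4 : ℝ) ^ n ≤ 1 := pow_le_one₀ (by norm_num) (by norm_num)
    rw [pow_succ', detRatio_mul quarter_mem h1 (by linarith), ih]

theorem le_detRatio_quarter {ε : ℝ} (hε : 0 < ε) : 8 / 15 ≤ detRatio (1 / 4) ε := by
  rw [detRatio, le_div_iff₀ (oneCorr_pos quarter_mem hε)]
  exact le_infCorr_quarter ε

/-! ### Upper and lower limits of multiplicatively periodic functions -/

theorem exists_pow_mul_mem_Icc {α a δ e : ℝ} (hα : 0 < α) (hα1 : α < 1) (ha : a ≤ α) (hδ : 0 < δ)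
    (he : δ ≤ e) : ∃ n : ℕ, α ^ n * e ∈ Icc (a * δ) δ := by
  have he0 : 0 < e := hδ.trans_le he
  obtain ⟨n, h1, h2⟩ := exists_nat_pow_near_of_lt_one (div_pos hδ he0) ((div_le_one he0).2 he)
    hα hα1
  rw [lt_div_iff₀ he0] at h1
  rw [div_le_iff₀ he0] at h2
  refine ⟨n + 1, ?_, h1.le⟩
  rw [pow_succ', mul_assoc]
  exact mul_le_mul ha h2 hδ.le hα.le

theorem exists_eq_pow_mul {α a δ ε : ℝ} (hα : 0 < α) (hα1 : α < 1) (ha : a ≤ α)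
    (hε : ε ∈ Ioc 0 δ) : ∃ n : ℕ, ∃ e ∈ Icc (a * δ) δ, ε = α ^ n * e := by
  have hδ : 0 < δ := hε.1.trans_le hε.2
  obtain ⟨n, h1, h2⟩ := exists_nat_pow_near_of_lt_one (div_pos hε.1 hδ) ((div_le_one hδ).2 hε.2)
    hα hα1
  rw [lt_div_iff₀ hδ] at h1
  rw [div_le_iff₀ hδ] at h2
  have hp : 0 < α ^ n := pow_pos hα n
  refine ⟨n, ε / α ^ n, ⟨?_, ?_⟩, (mul_div_cancel₀ _ hp.ne').symm⟩
  · rw [le_div_iff₀ hp]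
    rw [pow_succ'] at h1
    nlinarith [mul_le_mul_of_nonneg_right ha (mul_pos hp hδ).le]
  · rwa [div_le_iff₀ hp, mul_comm]

section Periodic

variable {φ : ℝ → ℝ} {α a δ : ℝ}

theorem pow_mul_invariant (hα : 0 < α) (hα1 : α < 1)
    (hinv : ∀ ε ∈ Ioc 0 δ, φ (α * ε) = φ ε) {e : ℝ} (he : e ∈ Ioc 0 δ) (n : ℕ) :
    φ (α ^ n * e) = φ e := by
  induction n with
  | zero => simp
  | succ n ih =>
    have hp : α ^ n ≤ 1 := pow_le_one₀ hα.le hα1.le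
    have hp' : 0 < α ^ n := pow_pos hα n
    rw [pow_succ', mul_assoc, hinv _ ⟨mul_pos hp' he.1, by nlinarith [he.1, he.2]⟩, ih]

theorem eventually_exists_eq_of_mul_invariant (hα : 0 < α) (hα1 : α < 1) (ha0 : 0 < a)
    (ha : a ≤ α) (hδ : 0 < δ) (hinv : ∀ ε ∈ Ioc 0 δ, φ (α * ε) = φ ε) :
    ∀ᶠ ε in 𝓝[>] 0, ∃ e ∈ Icc (a * δ) δ, φ ε = φ e := by
  filter_upwards [Ioc_mem_nhdsGT hδ] with ε hε
  obtain ⟨n, e, he, rfl⟩ := exists_eq_pow_mul hα hα1 ha hε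
  exact ⟨e, he, pow_mul_invariant hα hα1 hinv ⟨(mul_pos ha0 hδ).trans_le he.1, he.2⟩ n⟩

theorem frequently_eq_of_mul_invariant (hα : 0 < α) (hα1 : α < 1)
    (hinv : ∀ ε ∈ Ioc 0 δ, φ (α * ε) = φ ε) {e : ℝ} (he : e ∈ Ioc 0 δ) :
    ∃ᶠ ε in 𝓝[>] 0, φ ε = φ e := by
  have ht : Tendsto (fun n : ℕ => α ^ n * e) atTop (𝓝[>] 0) := by
    refine tendsto_nhdsWithin_iff.2 ⟨?_, Eventually.of_forall fun n =>
      mul_pos (pow_pos hα n) he.1⟩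
    simpa using (tendsto_pow_atTop_nhds_zero_of_lt_one hα.le hα1).mul_const e
  exact ht.frequently (Frequently.of_forall fun n => pow_mul_invariant hα hα1 hinv he n)

theorem limsup_eq_sSup_of_mul_invariant (hα : 0 < α) (hα1 : α < 1) (ha0 : 0 < a) (ha : a ≤ α)
    (hδ : 0 < δ) (hinv : ∀ ε ∈ Ioc 0 δ, φ (α * ε) = φ ε)
    (hc : ContinuousOn φ (Icc (a * δ) δ)) :
    limsup φ (𝓝[>] 0) = sSup (φ '' Icc (a * δ) δ) := by
  have hne : (Icc (a * δ) δ).Nonempty := nonempty_Icc.2 (by nlinarith)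
  obtain ⟨e, he, hsup⟩ := isCompact_Icc.exists_sSup_image_eq hne hc
  have hbdd := (isCompact_Icc.image_of_continuousOn hc).bddAbove
  have hle : ∀ᶠ ε in 𝓝[>] 0, φ ε ≤ sSup (φ '' Icc (a * δ) δ) := by
    filter_upwards [eventually_exists_eq_of_mul_invariant hα hα1 ha0 ha hδ hinv]
    rintro ε ⟨x, hx, h⟩
    exact h ▸ le_csSup hbdd (mem_image_of_mem φ hx)
  have hfr : ∃ᶠ ε in 𝓝[>] 0, sSup (φ '' Icc (a * δ) δ) ≤ φ ε := by
    rw [hsup]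
    exact (frequently_eq_of_mul_invariant hα hα1 hinv
      ⟨(mul_pos ha0 hδ).trans_le he.1, he.2⟩).mono fun ε h => h.ge
  exact le_antisymm (limsup_le_of_le (IsCoboundedUnder.of_frequently_ge hfr) hle)
    (le_limsup_of_frequently_le hfr ⟨_, hle⟩)

theorem liminf_eq_sInf_of_mul_invariant (hα : 0 < α) (hα1 : α < 1) (ha0 : 0 < a) (ha : a ≤ α)
    (hδ : 0 < δ) (hinv : ∀ ε ∈ Ioc 0 δ, φ (α * ε) = φ ε)
    (hc : ContinuousOn φ (Icc (a * δ) δ)) :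
    liminf φ (𝓝[>] 0) = sInf (φ '' Icc (a * δ) δ) := by
  have hne : (Icc (a * δ) δ).Nonempty := nonempty_Icc.2 (by nlinarith)
  obtain ⟨e, he, hinf⟩ := isCompact_Icc.exists_sInf_image_eq hne hc
  have hbdd := (isCompact_Icc.image_of_continuousOn hc).bddBelow
  have hle : ∀ᶠ ε in 𝓝[>] 0, sInf (φ '' Icc (a * δ) δ) ≤ φ ε := by
    filter_upwards [eventually_exists_eq_of_mul_invariant hα hα1 ha0 ha hδ hinv]
    rintro ε ⟨x, hx, h⟩
    exact h ▸ csInf_le hbdd (mem_image_of_mem φ hx)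
  have hfr : ∃ᶠ ε in 𝓝[>] 0, φ ε ≤ sInf (φ '' Icc (a * δ) δ) := by
    rw [hinf]
    exact (frequently_eq_of_mul_invariant hα hα1 hinv
      ⟨(mul_pos ha0 hδ).trans_le he.1, he.2⟩).mono fun ε h => h.le
  exact le_antisymm (liminf_le_of_frequently_le hfr ⟨_, hle⟩)
    (le_liminf_of_le (IsCoboundedUnder.of_frequently_le hfr) hle)

end Periodic

/-! ### Upper and lower determinism as continuous functions of the parameter -/

theorem continuousOn_detRatio_right {α : ℝ} (hα : α ∈ Ioc (0 : ℝ) (1 / 2)) :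
    ContinuousOn (detRatio α) (Ioi 0) :=
  continuousOn_detRatio.comp (f := fun ε => (α, ε)) (by fun_prop) fun _ h => ⟨hα, h⟩

/-- The maximum of the determinism over the fundamental domain `[δ/4, δ]`. -/
noncomputable def detMax (δ α : ℝ) : ℝ := sSup (detRatio α '' Icc (1 / 4 * δ) δ)

/-- The minimum of the determinism over the fundamental domain `[δ/4, δ]`. -/
noncomputable def detMin (δ α : ℝ) : ℝ := sInf (detRatio α '' Icc (1 / 4 * δ) δ)

theorem isCompact_image_detRatio {α δ : ℝ} (hα : α ∈ Ioc (0 : ℝ) (1 / 2)) (hδ : 0 < δ) :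
    IsCompact (detRatio α '' Icc (1 / 4 * δ) δ) :=
  isCompact_Icc.image_of_continuousOn <| (continuousOn_detRatio_right hα).mono fun _ h =>
    lt_of_lt_of_le (by positivity) h.1

/-- On `[1/4, 1/2] × [δ/4, δ]` the determinism agrees with a globally continuous function, obtained
by clamping both variables. -/
theorem exists_continuous_extension {δ : ℝ} (hδ : 0 < δ) :
    ∃ f : ℝ → ℝ → ℝ, Continuous (Function.uncurry f) ∧ ∀ α ∈ Icc (1 / 4 : ℝ) (1 / 2),
      f α '' Icc (1 / 4 * δ) δ = detRatio α '' Icc (1 / 4 * δ) δ := by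
  refine ⟨fun α ε => detRatio (max (1 / 4) (min α (1 / 2))) (max (1 / 4 * δ) ε), ?_, ?_⟩
  · refine continuousOn_detRatio.comp_continuous
      (f := fun p : ℝ × ℝ => (max (1 / 4) (min p.1 (1 / 2)), max (1 / 4 * δ) p.2)) (by fun_prop) ?_
    intro p
    refine ⟨⟨lt_of_lt_of_le (by norm_num) (le_max_left _ _), max_le (by norm_num)
      (min_le_right _ _)⟩, lt_of_lt_of_le (by positivity : 0 < 1 / 4 * δ) (le_max_left _ _)⟩
  · intro α hα
    refine image_congr fun ε hε => ?_
    simp only [min_eq_left hα.2, max_eq_right hα.1, max_eq_right hε.1]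

theorem continuousOn_detMax {δ : ℝ} (hδ : 0 < δ) :
    ContinuousOn (detMax δ) (Icc (1 / 4) (1 / 2)) := by
  obtain ⟨f, hf, h⟩ := exists_continuous_extension hδ
  exact (isCompact_Icc.continuous_sSup hf).continuousOn.congr fun α hα =>
    congrArg sSup (h α hα).symm

theorem continuousOn_detMin {δ : ℝ} (hδ : 0 < δ) :
    ContinuousOn (detMin δ) (Icc (1 / 4) (1 / 2)) := by
  obtain ⟨f, hf, h⟩ := exists_continuous_extension hδ
  exact (isCompact_Icc.continuous_sInf hf).continuousOn.congr fun α hα =>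
    congrArg sInf (h α hα).symm

theorem limsup_detInfty {α δ : ℝ} (hα : α ∈ Ico (1 / 4 : ℝ) (1 / 2)) (hδ : δ ∈ Ioc (0 : ℝ) 1)
    (h : δ ≤ 1 - 2 * α) :
    limsup (fun ε : ℝ => detInfty (delahaye α) (muAlpha α) ε) (𝓝[>] 0) = detMax δ α := by
  have hα' : α ∈ Ioo (0 : ℝ) (1 / 2) := ⟨by linarith [hα.1], hα.2⟩
  have hα'' : α ∈ Ioc (0 : ℝ) (1 / 2) := ⟨hα'.1, hα'.2.le⟩
  rw [limsup_congr (v := detRatio α), detMax]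
  · refine limsup_eq_sSup_of_mul_invariant hα'.1 (by linarith [hα.2]) (by norm_num) hα.1 hδ.1
      (fun ε hε => detRatio_mul hα'' (hε.2.trans hδ.2) ?_)
      ((continuousOn_detRatio_right hα'').mono fun _ h =>
        lt_of_lt_of_le (mul_pos (by norm_num) hδ.1) h.1)
    nlinarith [hε.1, hε.2, hα.2]
  · filter_upwards [self_mem_nhdsWithin] with ε hε
    exact detInfty_eq hα' (le_of_lt hε)

theorem liminf_detInfty {α δ : ℝ} (hα : α ∈ Ico (1 / 4 : ℝ) (1 / 2)) (hδ : δ ∈ Ioc (0 : ℝ) 1)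
    (h : δ ≤ 1 - 2 * α) :
    liminf (fun ε : ℝ => detInfty (delahaye α) (muAlpha α) ε) (𝓝[>] 0) = detMin δ α := by
  have hα' : α ∈ Ioo (0 : ℝ) (1 / 2) := ⟨by linarith [hα.1], hα.2⟩
  have hα'' : α ∈ Ioc (0 : ℝ) (1 / 2) := ⟨hα'.1, hα'.2.le⟩
  rw [liminf_congr (v := detRatio α), detMin]
  · refine liminf_eq_sInf_of_mul_invariant hα'.1 (by linarith [hα.2]) (by norm_num) hα.1 hδ.1
      (fun ε hε => detRatio_mul hα'' (hε.2.trans hδ.2) ?_)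
      ((continuousOn_detRatio_right hα'').mono fun _ h =>
        lt_of_lt_of_le (mul_pos (by norm_num) hδ.1) h.1)
    nlinarith [hε.1, hε.2, hα.2]
  · filter_upwards [self_mem_nhdsWithin] with ε hε
    exact detInfty_eq hα' (le_of_lt hε)

theorem nonempty_fundamental {δ : ℝ} (hδ : 0 < δ) : (Icc (1 / 4 * δ) δ).Nonempty :=
  nonempty_Icc.2 (by linarith)

/-- A continuous function on `[1/4, 1/2]` that is below `d` at `1/2` is below `d` at some
parameter smaller than `1/2`. -/
theorem exists_lt_of_lt_half {g : ℝ → ℝ} {d : ℝ} (hg : ContinuousOn g (Icc (1 / 4) (1 / 2)))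
    (h : g (1 / 2) < d) : ∃ β ∈ Ioo (1 / 4 : ℝ) (1 / 2), g β < d := by
  have hc := (hg (1 / 2) ⟨by norm_num, le_rfl⟩).mono (Ioo_subset_Icc_self)
  have hlt := hc.tendsto.eventually_lt_const h
  have : (𝓝[Ioo (1 / 4 : ℝ) (1 / 2)] (1 / 2)).NeBot := right_nhdsWithin_Ioo_neBot (by norm_num)
  obtain ⟨β, hβ, hβ'⟩ := (hlt.and self_mem_nhdsWithin).exists
  exact ⟨β, hβ', hβ⟩

theorem exists_limsup_detInfty_eq {d : ℝ} (hd : d ∈ Ioc (1 / 2 : ℝ) 1) :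
    ∃ α ∈ Ioo (0 : ℝ) (1 / 2),
      limsup (fun ε : ℝ => detInfty (delahaye α) (muAlpha α) ε) (𝓝[>] 0) = d := by
  have hd0 : 0 < d := by linarith [hd.1]
  -- at `α = 1/2` the determinism on `(0, η]` is at most `1 / (2 - η) < d`
  obtain ⟨η, hη0, hη⟩ : ∃ η : ℝ, 0 < η ∧ 1 / (2 - η) < d ∧ η < 1 := by
    have h2 : 1 / d < 2 := by rw [div_lt_iff₀ hd0]; linarith [hd.1]
    have h1 : 1 ≤ 1 / d := by rw [le_div_iff₀ hd0]; linarith [hd.2]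
    refine ⟨(2 - 1 / d) / 2, by linarith, ?_, by linarith⟩
    rw [div_lt_comm₀ (by linarith) hd0]
    linarith
  have hhalf : detMax η (1 / 2) < d := by
    refine lt_of_le_of_lt (csSup_le ((nonempty_fundamental hη0).image _) ?_) hη.1
    rintro _ ⟨ε, hε, rfl⟩
    have hε0 : 0 < ε := by linarith [hε.1]
    refine (detRatio_half_le ⟨hε0, by linarith [hε.2]⟩).trans ?_
    exact one_div_le_one_div_of_le (by linarith [hη.2]) (by linarith [hε.2])
  obtain ⟨β, hβ, hβd⟩ := exists_lt_of_lt_half (continuousOn_detMax hη0) hhalf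
  have hβ' : β ∈ Ioc (0 : ℝ) (1 / 2) := ⟨by linarith [hβ.1], hβ.2.le⟩
  have hδ0 : 0 < min η (1 - 2 * β) := lt_min hη0 (by linarith [hβ.2])
  have hδη := min_le_left η (1 - 2 * β)
  have hδβ := min_le_right η (1 - 2 * β)
  revert hδ0 hδη hδβ
  generalize min η (1 - 2 * β) = δ
  intro hδ0 hδη hδβ
  -- the determinism decreases along `ε, β ε, β² ε, …`
  have hβδ : detMax δ β < d := by
    refine lt_of_le_of_lt (csSup_le ((nonempty_fundamental hδ0).image _) ?_) hβd
    rintro _ ⟨ε, hε, rfl⟩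
    obtain ⟨n, e, he, rfl⟩ := exists_eq_pow_mul (δ := η) (a := 1 / 4) hβ'.1 (by linarith [hβ.2])
      hβ.1.le (⟨by linarith [hε.1], hε.2.trans hδη⟩ : ε ∈ Ioc 0 η)
    refine (detRatio_pow_mul_le hβ' ⟨by linarith [he.1], by linarith [he.2, hη.2]⟩ n).trans ?_
    exact le_csSup (isCompact_image_detRatio hβ' hη0).bddAbove (mem_image_of_mem _ he)
  have hquarter : d ≤ detMax δ (1 / 4) := by
    obtain ⟨n, hn⟩ := exists_pow_mul_mem_Icc (α := 1 / 4) (a := 1 / 4) (e := 1) (by norm_num)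
      (by norm_num) le_rfl hδ0 (by linarith [hη.2])
    rw [mul_one] at hn
    refine hd.2.trans (le_csSup (isCompact_image_detRatio quarter_mem hδ0).bddAbove ?_)
    exact ⟨_, hn, detRatio_quarter_pow n⟩
  obtain ⟨α, hα, hαd⟩ := intermediate_value_Icc' hβ.1.le
    ((continuousOn_detMax hδ0).mono (Icc_subset_Icc_right hβ.2.le)) ⟨hβδ.le, hquarter⟩
  refine ⟨α, ⟨by linarith [hα.1], by linarith [hα.2, hβ.2]⟩, ?_⟩
  rw [limsup_detInfty ⟨hα.1, by linarith [hα.2, hβ.2]⟩ ⟨hδ0, by linarith [hη.2]⟩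
    (by linarith [hα.2]), hαd]

theorem exists_liminf_detInfty_eq {d : ℝ} (hd : d ∈ Ioc (1 / 3 : ℝ) (8 / 15)) :
    ∃ α ∈ Ioo (0 : ℝ) (1 / 2),
      liminf (fun ε : ℝ => detInfty (delahaye α) (muAlpha α) ε) (𝓝[>] 0) = d := by
  -- at `α = 1/2` the determinism at the radii `3/4 * 2⁻ᵏ` tends to `1/3`
  obtain ⟨k, hk⟩ : ∃ k : ℕ, detRatio (1 / 2) (3 / 4 * (1 / 2) ^ k) < d := by
    have hlim : Tendsto (fun k : ℕ => detRatio (1 / 2) (3 / 4 * (1 / 2) ^ k)) atTop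
        (𝓝 (2 / 3 / (2 - 3 / 4 * 0))) := by
      simp only [detRatio_half_eq]
      refine tendsto_const_nhds.div (tendsto_const_nhds.sub (Tendsto.const_mul _ ?_)) (by norm_num)
      exact tendsto_pow_atTop_nhds_zero_of_lt_one (by norm_num) (by norm_num)
    exact (hlim.eventually_lt_const (by linarith [hd.1])).exists
  have he0 : (0 : ℝ) < 3 / 4 * (1 / 2) ^ k := by positivity
  have he1 : (3 / 4 * (1 / 2) ^ k : ℝ) ≤ 1 := by
    have : (1 / 2 : ℝ) ^ k ≤ 1 := pow_le_one₀ (by norm_num) (by norm_num)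
    linarith
  revert hk he0 he1
  generalize (3 / 4 * (1 / 2) ^ k : ℝ) = e
  intro hk he0 he1
  have hcont : ContinuousOn (fun α => detRatio α e) (Icc (1 / 4) (1 / 2)) :=
    continuousOn_detRatio.comp (f := fun α => (α, e)) (by fun_prop) fun α hα =>
      ⟨⟨by linarith [hα.1], hα.2⟩, he0⟩
  obtain ⟨β, hβ, hβd⟩ := exists_lt_of_lt_half hcont hk
  have hβ' : β ∈ Ioc (0 : ℝ) (1 / 2) := ⟨by linarith [hβ.1], hβ.2.le⟩
  have hδ0 : 0 < min e (1 - 2 * β) := lt_min he0 (by linarith [hβ.2])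
  have hδe := min_le_left e (1 - 2 * β)
  have hδβ := min_le_right e (1 - 2 * β)
  revert hδ0 hδe hδβ
  generalize min e (1 - 2 * β) = δ
  intro hδ0 hδe hδβ
  -- the determinism decreases along `e, β e, β² e, …`, which meets `[δ/4, δ]`
  have hβδ : detMin δ β < d := by
    obtain ⟨n, hn⟩ := exists_pow_mul_mem_Icc (a := 1 / 4) hβ'.1 (by linarith [hβ.2]) hβ.1.le hδ0 hδe
    refine lt_of_le_of_lt ?_ hβd
    exact (csInf_le (isCompact_image_detRatio hβ' hδ0).bddBelow (mem_image_of_mem _ hn)).trans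
      (detRatio_pow_mul_le hβ' ⟨he0, he1⟩ n)
  have hquarter : d ≤ detMin δ (1 / 4) := by
    refine hd.2.trans (le_csInf ((nonempty_fundamental hδ0).image _) ?_)
    rintro _ ⟨ε, hε, rfl⟩
    exact le_detRatio_quarter (by linarith [hε.1])
  obtain ⟨α, hα, hαd⟩ := intermediate_value_Icc' hβ.1.le
    ((continuousOn_detMin hδ0).mono (Icc_subset_Icc_right hβ.2.le)) ⟨hβδ.le, hquarter⟩
  refine ⟨α, ⟨by linarith [hα.1], by linarith [hα.2, hβ.2]⟩, ?_⟩
  rw [liminf_detInfty ⟨hα.1, by linarith [hα.2, hβ.2]⟩ ⟨hδ0, by linarith⟩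
    (by linarith [hα.2]), hαd]

theorem mainTheorem2 :
    (∀ d ∈ Ioc (1 / 2 : ℝ) 1, ∃ α ∈ Ioo (0 : ℝ) (1 / 2),
      limsup (fun ε : ℝ => detInfty (delahaye α) (muAlpha α) ε) (𝓝[>] 0) = d) ∧
    (∀ d ∈ Ioc (1 / 3 : ℝ) (8 / 15), ∃ α ∈ Ioo (0 : ℝ) (1 / 2),
      liminf (fun ε : ℝ => detInfty (delahaye α) (muAlpha α) ε) (𝓝[>] 0) = d) :=
  ⟨fun _ hd => exists_limsup_detInfty_eq hd, fun _ hd => exists_liminf_detInfty_eq hd⟩
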